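/- Let $N\in\mathbb N$, $N\ge 1$, let $m,n\in\mathbb N_0$ with $n<m$, let $\sigma\in(0,1)$ and $s=n+\sigma$. **Notation.** For $u:\mathbb R^N\to\mathbb R$ put $$L_{m,s}u(x):=\frac{c_{N,m,s}}{2}\int_{\mathbb R^N}\frac{\delta_m u(x,y)}{|y|^{N+2s}}\,dy,\qquad \delta_m u(x,y):=\sum_{k=-m}^{m}(-1)^k\binom{2m}{m-k}u(x+ky),$$ $$c_{N,m,s}:=\frac{4^s\,\Gamma(\frac N2+s)}{\pi^{N/2}\,\Gamma(-s)}\Big(\sum_{k=1}^m(-1)^k\binom{2m}{m-k}k^{2s}\Big)^{-1},$$ and let $$(-\Delta)^\sigma v(x):=-\frac{4^\sigma\,\Gamma(\frac N2+\sigma)}{2\pi^{N/2}\,\Gamma(-\sigma)}\int_{\mathbb R^N}\frac{2v(x)-v(x+y)-v(x-y)}{|y|^{N+2\sigma}}\,dy$$ be the fractional Laplacian. For $t>0$ let $\mathcal L^1_t$ be the set of all $f\in L^1_{loc}(\mathbb R^N)$ with $\int_{\mathbb R^N}\frac{|f(x)|}{1+|x|^{N+2t}}\,dx<\infty$. For $U\subset\mathbb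 R^N$ open and $a=k+\tau$ with $k\in\mathbb N_0$, $\tau\in(0,1]$, let $C^a(U)$ be the set of functions that are $k$ times continuously differentiable in $U$ and whose derivatives of order $k$ are locally $\tau$-Hölder continuous in $U$. Let $W^{k,1}_{loc}(\mathbb R^N)$ be the set of functions in $L^1_{loc}(\mathbb R^N)$ all of whose weak derivatives of order at most $k$ exist in $L^1_{loc}(\mathbb R^N)$. **Theorem.** Let $\beta>0$, let $U\subset\mathbb R^N$ be open, and let $u\in C^{2s+\beta}(U)\cap W^{2n,1}_{loc}(\mathbb R^N)$ be such that $(-\Delta)^n u\in\mathcal L^1_\sigma$ and, for every $i\in\{0,\dots,n-1\}$, $$(-\Delta)^i u\in\mathcal L^1_{s-i-\frac12}\qquad\text{and}\qquad |\nabla(-\Delta)^i u|\in\mathcal L^1_{s-i-1},$$ where $(-\Delta)^iu=(-\sum_{j}\partial_{jj})^iu$ and the gradients are taken in the weak sense on $\mathbb R^N$, and $(-\Delta)^nu$ is represented by a function that has its classical values in $U$. Then for every $x\in U$ the integrals defining $L_{m,s}u(x)$ and $(-\Delta)^\sigma(-\Delta)^nu(x)$ converge absolutely, and $$L_{m,s}u(x)=(-\Delta)^\sigma(-\Delta)^n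 u(x).$$ In particular, this holds for all $x\in\mathbb R^N$ whenever $u\in C_c^\infty(\mathbb R^N)$. -/

import Mathlib

open MeasureTheory Set Filter Topology
open scoped ContDiff

/-- The Euclidean space `ℝ^N`. -/
abbrev RN (N : ℕ) : Type := EuclideanSpace ℝ (Fin N)

noncomputable section

/-! ### The hypersingular integral and the fractional Laplacian -/

/-- The finite difference of order `2m`,
`δ_m u(x,y) = ∑_{k=-m}^{m} (-1)^k (2m choose m-k) u(x + k y)`. -/
def finDiff {N : ℕ} (m : ℕ) (u : RN N → ℝ) (x y : RN N) : ℝ :=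
  ∑ k ∈ Finset.Icc (-(m : ℤ)) (m : ℤ),
    (-1 : ℝ) ^ k * ((2 * m).choose ((m : ℤ) - k).toNat : ℝ) * u (x + (k : ℝ) • y)

/-- The normalizing constant `c_{N,m,s}` for non-integer `s ∈ (0,m)`. -/
def hyperConst (N m : ℕ) (s : ℝ) : ℝ :=
  (4 : ℝ) ^ s * Real.Gamma ((N : ℝ) / 2 + s) / (Real.pi ^ ((N : ℝ) / 2) * Real.Gamma (-s)) *
    (∑ k ∈ Finset.Icc 1 m,
      (-1 : ℝ) ^ k * ((2 * m).choose (m - k) : ℝ) * (k : ℝ) ^ (2 * s))⁻¹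

/-- The integrand `δ_m u(x,y) / |y|^{N+2s}` of the hypersingular integral. -/
def hyperIntegrand {N : ℕ} (m : ℕ) (s : ℝ) (u : RN N → ℝ) (x y : RN N) : ℝ :=
  finDiff m u x y / ‖y‖ ^ ((N : ℝ) + 2 * s)

/-- `L_{m,s} u(x) = (c_{N,m,s} / 2) ∫ δ_m u(x,y) / |y|^{N+2s} dy` (for non-integer `s ∈ (0,m)`). -/
def hyperL {N : ℕ} (m : ℕ) (s : ℝ) (u : RN N → ℝ) (x : RN N) : ℝ :=
  hyperConst N m s / 2 * ∫ y : RN N, hyperIntegrand m s u x y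

/-- The integrand `(2 v(x) - v(x+y) - v(x-y)) / |y|^{N+2σ}` of the fractional Laplacian. -/
def fracLapIntegrand {N : ℕ} (σ : ℝ) (v : RN N → ℝ) (x y : RN N) : ℝ :=
  (2 * v x - v (x + y) - v (x - y)) / ‖y‖ ^ ((N : ℝ) + 2 * σ)

/-- The fractional Laplacian `(-Δ)^σ v(x)`, `σ ∈ (0,1)`. -/
def fracLap {N : ℕ} (σ : ℝ) (v : RN N → ℝ) (x : RN N) : ℝ :=
  -((4 : ℝ) ^ σ * Real.Gamma ((N : ℝ) / 2 + σ) /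
      (2 * Real.pi ^ ((N : ℝ) / 2) * Real.Gamma (-σ))) *
    ∫ y : RN N, fracLapIntegrand σ v x y

/-! ### Function spaces -/

/-- The space `𝓛¹_s` of locally integrable `f` with `∫ |f(x)| / (1 + |x|^{N+2s}) dx < ∞`. -/
def MemL1Weight {N : ℕ} (s : ℝ) (f : RN N → ℝ) : Prop :=
  LocallyIntegrable f ∧
    Integrable (fun x : RN N => |f x| / (1 + ‖x‖ ^ ((N : ℝ) + 2 * s)))

/-- `u ∈ C^a(U)` for `U` open and `a > 0`: writing `a = k + τ` with `k ∈ ℕ₀`, `τ ∈ (0,1]` (in the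
only possible way), `u` is `k` times continuously differentiable in `U` and its derivatives of
order `k` are locally `τ`-Hölder continuous in `U`. -/
def MemHolderLoc {N : ℕ} (a : ℝ) (U : Set (RN N)) (u : RN N → ℝ) : Prop :=
  ∃ (k : ℕ) (τ : ℝ), 0 < τ ∧ τ ≤ 1 ∧ a = k + τ ∧ ContDiffOn ℝ k u U ∧
    ∀ x ∈ U, ∃ V ∈ 𝓝 x, ∃ C : ℝ, ∀ y ∈ V, ∀ z ∈ V,
      ‖iteratedFDeriv ℝ k u y - iteratedFDeriv ℝ k u z‖ ≤ C * ‖y - z‖ ^ τ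

/-- Smooth compactly supported functions on `ℝ^N`. -/
def IsTestFun {N : ℕ} (φ : RN N → ℝ) : Prop :=
  ContDiff ℝ ∞ φ ∧ HasCompactSupport φ

/-- `g ∈ L¹_loc` is the weak partial derivative `∂_{α 0} ⋯ ∂_{α (k-1)} u` on `ℝ^N`. -/
def HasWeakPartial {N k : ℕ} (α : Fin k → Fin N) (u g : RN N → ℝ) : Prop :=
  LocallyIntegrable g ∧ ∀ φ : RN N → ℝ, IsTestFun φ →
    ∫ x, u x * iteratedFDeriv ℝ k φ x (fun j => EuclideanSpace.single (α j) (1 : ℝ)) =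
      (-1 : ℝ) ^ k * ∫ x, g x * φ x

/-- The Sobolev space `W^{k,1}_loc(ℝ^N)`: `u` and all its weak partial derivatives of order at
most `k` are locally integrable functions. -/
def MemW1Loc {N : ℕ} (k : ℕ) (u : RN N → ℝ) : Prop :=
  LocallyIntegrable u ∧
    ∀ l ≤ k, ∀ α : Fin l → Fin N, ∃ g : RN N → ℝ, HasWeakPartial α u g

/-! ### Powers of the Laplacian and gradients -/

/-- The classical operator `(-Δ)^i = (-∑_j ∂_{jj})^i`. -/
def classicalNegLapPow {N : ℕ} (i : ℕ) (u : RN N → ℝ) (x : RN N) : ℝ :=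
  (-1 : ℝ) ^ i * (Laplacian.laplacian^[i] u) x

/-- `v ∈ L¹_loc` is `(-Δ)^i u` in the weak sense on `ℝ^N`. -/
def HasWeakNegLapPow {N : ℕ} (i : ℕ) (u v : RN N → ℝ) : Prop :=
  LocallyIntegrable v ∧ ∀ φ : RN N → ℝ, IsTestFun φ →
    ∫ x, u x * classicalNegLapPow i φ x = ∫ x, v x * φ x

open Classical in
/-- A representative of the weak `(-Δ)^i u` (zero if there is none; there always is one for
`u ∈ W^{2i,1}_loc`). It is determined up to null sets. -/
def weakNegLapPow {N : ℕ} (i : ℕ) (u : RN N → ℝ) : RN N → ℝ :=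
  if h : ∃ v, HasWeakNegLapPow i u v then Classical.choose h else 0

open Classical in
/-- The function `(-Δ)^i u`: at every point near which `u` is of class `C^{2i}` it is the classical
pointwise value; elsewhere it is a representative of the weak `(-Δ)^i u`. The two agree almost
everywhere where both are available, so that for `u ∈ W^{2i,1}_loc` this is the representative of
the weak `(-Δ)^i u` that has its classical values wherever `u` is locally `C^{2i}`. -/
def negLapPow {N : ℕ} (i : ℕ) (u : RN N → ℝ) (x : RN N) : ℝ :=
  if ContDiffAt ℝ ((2 * i : ℕ) : WithTop ℕ∞) u x then classicalNegLapPow i u x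
  else weakNegLapPow i u x

/-- `G ∈ L¹_loc` is the weak gradient of `f` on `ℝ^N`. -/
def HasWeakGradient {N : ℕ} (f : RN N → ℝ) (G : RN N → RN N) : Prop :=
  LocallyIntegrable G ∧ ∀ φ : RN N → ℝ, IsTestFun φ →
    ∫ x, f x • gradient φ x = -∫ x, φ x • G x

open Classical in
/-- A representative of the weak gradient `∇f` (zero if there is none). It is determined up to
null sets. -/
def weakGradient {N : ℕ} (f : RN N → ℝ) : RN N → RN N :=
  if h : ∃ G, HasWeakGradient f G then Classical.choose h else 0

end

/-! ### Iterated Laplacians: regularity, locality, scaling and Green's identity. -/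

section LaplacianPowers

variable {N : ℕ}

/-! The idea is to move `(-Δ)^n` from `u` to the kernel. With `q = -(N + 2σ)`, away from the origin
`Δ^n |y|^q` is an explicit nonzero multiple of `|y|^(q - 2n) = |y|^(-N - 2s)`
(`iterate_laplacian_norm_rpow`), so the hypersingular kernel is, up to a constant, `(-Δ)^n` of the
kernel of `(-Δ)^σ`.

For a test function `φ` in place of the kernel, the weak formulation of `v = (-Δ)^n u` and the
substitution `z = x + k y` turn each term `u(x + k y)` of the difference into `k^(2n) v(x + k y)`.
Since `2n < 2m`, the moment `∑ c_k k^(2n)` of the difference vanishes; this brings in the value `v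
x` and groups the terms into second differences of `v` with steps `k y`
(`HasWeakNegLapPow.integral_finDiff_mul`).

The true kernel is reached through the test functions `truncKernel N q R`. Their iterated Laplacians
are bounded by `C |y|^(q - 2n)` with `C` independent of `R`, because both cutoffs are dilations of
one profile. Dominated convergence then applies as soon as the two singular integrals converge
absolutely, and no boundary terms appear. Scaling `y` by `k` contributes `k^(2σ)`, so the sum in the
normalizing constant emerges (`HasWeakNegLapPow.integral_hyperIntegrand`).

Absolute convergence comes from Taylor's formula near the origin, where the vanishing moments remove
the Taylor polynomial, and from the weighted `L¹` condition elsewhere (`integrable_hyperIntegrand`).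
The constants match by the recursion of the Gamma function (`gamma_const_add`). The normalizing sum
is nonzero by the same identity applied to the cosine on the line, whose difference at `0` is `(4
sin²(y/2))^m` (`hyperSum_ne_zero`). -/

theorem ContDiffAt.eventually_nat {k : ℕ} {f : RN N → ℝ} {x : RN N}
    (hf : ContDiffAt ℝ (k : WithTop ℕ∞) f x) : ∀ᶠ y in 𝓝 x, ContDiffAt ℝ (k : WithTop ℕ∞) f y :=
  hf.eventually (by exact_mod_cast ENat.natCast_ne_top k)

theorem laplacian_eq_sum_fderiv (f : RN N → ℝ) (x : RN N) :
    Laplacian.laplacian f x = ∑ i : Fin N, fderiv ℝ (fderiv ℝ f) x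
      (EuclideanSpace.single i 1) (EuclideanSpace.single i 1) := by
  rw [InnerProductSpace.laplacian_eq_iteratedFDeriv_orthonormalBasis f
    (EuclideanSpace.basisFun (Fin N) ℝ)]
  simp [iteratedFDeriv_two_apply]

/-- On functions of class `C^{2n}`, the `n`-th power of the Laplacian is a sum of iterated partial
derivatives. -/
theorem exists_iterate_laplacian_eq_sum (N n : ℕ) :
    ∃ (ι : Type) (_ : Fintype ι) (α : ι → Fin (2 * n) → Fin N), ∀ (f : RN N → ℝ) (x : RN N),
      ContDiffAt ℝ ((2 * n : ℕ) : WithTop ℕ∞) f x →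
      (Laplacian.laplacian^[n] f) x =
        ∑ i, iteratedFDeriv ℝ (2 * n) f x (fun j => EuclideanSpace.single (α i j) (1 : ℝ)) := by
  induction n with
  | zero => exact ⟨Unit, inferInstance, fun _ j => j.elim0, fun f x _ => by simp⟩
  | succ n ih =>
    obtain ⟨ι, _, α, h⟩ := ih
    -- The outer Laplacian differentiates twice in one direction `i`, so `i` is prepended twice to
    -- each earlier multi-index.
    refine ⟨Fin N × ι, inferInstance,
      fun p => (Fin.cons p.1 (Fin.cons p.1 (α p.2) : Fin (2 * n + 1) → Fin N) :
        Fin (2 * n + 1 + 1) → Fin N), fun f x hf => ?_⟩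
    rw [Function.iterate_succ_apply', Fintype.sum_prod_type]
    have hev : (Laplacian.laplacian^[n] f) =ᶠ[𝓝 x] fun y => ∑ i, iteratedFDeriv ℝ (2 * n) f y
        (fun j => EuclideanSpace.single (α i j) (1 : ℝ)) := by
      filter_upwards [hf.eventually_nat] with y hy
      exact h f y (hy.of_le (by exact_mod_cast (by omega)))
    rw [(InnerProductSpace.laplacian_congr_nhds hev).eq_of_nhds, laplacian_eq_sum_fderiv]
    refine Finset.sum_congr rfl fun i _ => ?_
    have hd0 : ∀ᶠ y in 𝓝 x, DifferentiableAt ℝ (iteratedFDeriv ℝ (2 * n) f) y := by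
      filter_upwards [hf.eventually_nat] with y hy
      exact hy.differentiableAt_iteratedFDeriv (by exact_mod_cast (by omega))
    have hd1 : DifferentiableAt ℝ (iteratedFDeriv ℝ (2 * n + 1) f) x :=
      hf.differentiableAt_iteratedFDeriv (by exact_mod_cast (by omega))
    have hfd : fderiv ℝ (fun y => ∑ i, iteratedFDeriv ℝ (2 * n) f y
        (fun j => EuclideanSpace.single (α i j) (1 : ℝ))) =ᶠ[𝓝 x] fun y =>
        ∑ k, fderiv ℝ (fun y => iteratedFDeriv ℝ (2 * n) f y
          (fun j => EuclideanSpace.single (α k j) (1 : ℝ))) y := by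
      filter_upwards [hd0] with y hy
      exact fderiv_fun_sum fun k _ => hy.continuousMultilinear_apply_const _
    have hdc : ∀ k, DifferentiableAt ℝ (fderiv ℝ (fun y => iteratedFDeriv ℝ (2 * n) f y
          (fun j => EuclideanSpace.single (α k j) (1 : ℝ)))) x := by
      intro k
      have : ContDiffAt ℝ 2 (fun y => iteratedFDeriv ℝ (2 * n) f y
          (fun j => EuclideanSpace.single (α k j) (1 : ℝ))) x :=
        (ContinuousMultilinearMap.apply ℝ (fun _ : Fin (2 * n) => RN N) ℝ _).contDiff.contDiffAt.comp
          x (hf.iteratedFDeriv_right (m := 2) (i := 2 * n)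
            (by norm_cast; omega))
      exact (this.fderiv_right (m := 1) (by norm_num)).differentiableAt (by norm_num)
    rw [hfd.fderiv_eq, fderiv_fun_sum fun k _ => hdc k]
    simp only [FunLike.coe_sum, Finset.sum_apply]
    refine Finset.sum_congr rfl fun k _ => ?_
    change _ = iteratedFDeriv ℝ (2 * n + 1 + 1) f x _
    rw [hd1.iteratedFDeriv_succ_apply_left']
    have hev2 : (fun y => iteratedFDeriv ℝ (2 * n + 1) f y
        (Fin.tail fun j => EuclideanSpace.single
          ((Fin.cons i (Fin.cons i (α k) : Fin (2 * n + 1) → Fin N) :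
            Fin (2 * n + 1 + 1) → Fin N) j) (1 : ℝ))) =ᶠ[𝓝 x]
        fun y => fderiv ℝ (fun y => iteratedFDeriv ℝ (2 * n) f y
          (fun j => EuclideanSpace.single (α k j) (1 : ℝ))) y (EuclideanSpace.single i 1) := by
      filter_upwards [hd0] with y hy
      rw [hy.iteratedFDeriv_succ_apply_left']
      rfl
    refine Eq.trans ?_ (congrArg (fun L : RN N →L[ℝ] ℝ => L (EuclideanSpace.single i (1 : ℝ)))
      hev2.fderiv_eq.symm)
    rw [((hdc k).hasFDerivAt.clm_apply
      (hasFDerivAt_const (EuclideanSpace.single i (1 : ℝ)) x)).fderiv]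
    simp

/-- On functions of class `C^{2n}`, the `n`-th power of the Laplacian is a continuous linear
functional of the derivative of order `2n`. -/
theorem exists_iterate_laplacian_eq_clm (N n : ℕ) :
    ∃ Λ : (ContinuousMultilinearMap ℝ (fun _ : Fin (2 * n) => RN N) ℝ) →L[ℝ] ℝ,
      ∀ (f : RN N → ℝ) (x : RN N), ContDiffAt ℝ ((2 * n : ℕ) : WithTop ℕ∞) f x →
      (Laplacian.laplacian^[n] f) x = Λ (iteratedFDeriv ℝ (2 * n) f x) := by
  obtain ⟨ι, _, α, h⟩ := exists_iterate_laplacian_eq_sum N n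
  refine ⟨∑ i, ContinuousMultilinearMap.apply ℝ (fun _ : Fin (2 * n) => RN N) ℝ
    (fun j => EuclideanSpace.single (α i j) (1 : ℝ)), fun f x hf => ?_⟩
  rw [h f x hf]
  simp

theorem ContDiffAt.iterate_laplacian {n k : ℕ} {f : RN N → ℝ} {x : RN N}
    (hf : ContDiffAt ℝ ((2 * n + k : ℕ) : WithTop ℕ∞) f x) :
    ContDiffAt ℝ (k : WithTop ℕ∞) (Laplacian.laplacian^[n] f) x := by
  obtain ⟨Λ, h⟩ := exists_iterate_laplacian_eq_clm N n
  have hev : (Laplacian.laplacian^[n] f) =ᶠ[𝓝 x] fun y => Λ (iteratedFDeriv ℝ (2 * n) f y) := by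
    filter_upwards [hf.eventually_nat] with y hy
    exact h f y (hy.of_le (by exact_mod_cast (by omega)))
  refine ContDiffAt.congr_of_eventuallyEq ?_ hev
  exact Λ.contDiff.contDiffAt.comp x (hf.iteratedFDeriv_right (by norm_cast; omega))

theorem ContDiffAt.continuousAt_iterate_laplacian {n : ℕ} {f : RN N → ℝ} {x : RN N}
    (hf : ContDiffAt ℝ ((2 * n : ℕ) : WithTop ℕ∞) f x) :
    ContinuousAt (Laplacian.laplacian^[n] f) x :=
  (ContDiffAt.iterate_laplacian (k := 0) hf).continuousAt

theorem ContDiff.iterate_laplacian {f : RN N → ℝ} (hf : ContDiff ℝ ∞ f) (n : ℕ) :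
    ContDiff ℝ ∞ (Laplacian.laplacian^[n] f) := by
  rw [contDiff_infty]
  intro k
  rw [contDiff_iff_contDiffAt]
  intro x
  exact ContDiffAt.iterate_laplacian (contDiff_infty.1 hf (2 * n + k)).contDiffAt

theorem tsupport_laplacian_subset (f : RN N → ℝ) :
    tsupport (Laplacian.laplacian f) ⊆ tsupport f := by
  intro x hx
  by_contra hfx
  rw [notMem_tsupport_iff_eventuallyEq] at hfx
  refine (notMem_tsupport_iff_eventuallyEq.2 ?_) hx
  refine (InnerProductSpace.laplacian_congr_nhds hfx).trans ?_
  have : (0 : RN N → ℝ) = fun _ => 0 := rfl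
  rw [this, InnerProductSpace.laplacian_const]
  rfl

theorem tsupport_iterate_laplacian_subset (f : RN N → ℝ) (n : ℕ) :
    tsupport (Laplacian.laplacian^[n] f) ⊆ tsupport f := by
  induction n with
  | zero => simp
  | succ n ih =>
    rw [Function.iterate_succ_apply']
    exact (tsupport_laplacian_subset _).trans ih

theorem HasCompactSupport.iterate_laplacian {f : RN N → ℝ} (hf : HasCompactSupport f) (n : ℕ) :
    HasCompactSupport (Laplacian.laplacian^[n] f) :=
  hf.of_isClosed_subset isClosed_closure (tsupport_iterate_laplacian_subset f n)

theorem iterate_laplacian_congr_nhds {f g : RN N → ℝ} {x : RN N} (h : f =ᶠ[𝓝 x] g) (n : ℕ) :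
    (Laplacian.laplacian^[n] f) =ᶠ[𝓝 x] (Laplacian.laplacian^[n] g) := by
  induction n with
  | zero => exact h
  | succ n ih =>
    rw [Function.iterate_succ_apply', Function.iterate_succ_apply']
    exact InnerProductSpace.laplacian_congr_nhds ih

theorem iterate_laplacian_const (n : ℕ) (hn : n ≠ 0) (c : ℝ) :
    (Laplacian.laplacian^[n] (fun _ : RN N => c)) = 0 := by
  obtain ⟨n, rfl⟩ := Nat.exists_eq_succ_of_ne_zero hn
  induction n with
  | zero => simp
  | succ n ih =>
    rw [Function.iterate_succ_apply', ih (by omega)]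
    exact InnerProductSpace.laplacian_const (c := (0 : ℝ))

theorem iterate_laplacian_sub {n : ℕ} {f g : RN N → ℝ} {x : RN N}
    (hf : ContDiffAt ℝ ((2 * n : ℕ) : WithTop ℕ∞) f x)
    (hg : ContDiffAt ℝ ((2 * n : ℕ) : WithTop ℕ∞) g x) :
    (Laplacian.laplacian^[n] (f - g)) x =
      (Laplacian.laplacian^[n] f) x - (Laplacian.laplacian^[n] g) x := by
  obtain ⟨Λ, h⟩ := exists_iterate_laplacian_eq_clm N n
  rw [h _ x hf, h _ x hg, h (f - g) x (hf.sub hg), iteratedFDeriv_sub_apply hf hg, map_sub]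

theorem iterate_laplacian_const_mul {n : ℕ} {f : RN N → ℝ} {x : RN N} (c : ℝ)
    (hf : ContDiffAt ℝ ((2 * n : ℕ) : WithTop ℕ∞) f x) :
    (Laplacian.laplacian^[n] (fun y => c * f y)) x = c * (Laplacian.laplacian^[n] f) x := by
  obtain ⟨Λ, h⟩ := exists_iterate_laplacian_eq_clm N n
  have hcf : ContDiffAt ℝ ((2 * n : ℕ) : WithTop ℕ∞) (fun y => c * f y) x :=
    contDiffAt_const.mul hf
  rw [h _ x hf, h _ x hcf]
  have := iteratedFDeriv_const_smul_apply' (a := c) hf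
  simp only [smul_eq_mul] at this
  rw [this, map_smul, smul_eq_mul]

theorem iteratedFDeriv_comp_affine (i : ℕ) {f : RN N → ℝ} {c : ℝ} (hc : c ≠ 0) (a x : RN N) :
    iteratedFDeriv ℝ i (fun z => f (c • (z - a))) x =
      c ^ i • iteratedFDeriv ℝ i f (c • (x - a)) := by
  have h1 : iteratedFDeriv ℝ i (fun z => f (c • (z - a))) x =
      iteratedFDeriv ℝ i (fun z => f (c • z)) (x - a) := by
    rw [← iteratedFDeriv_comp_sub i a x]
  rw [h1]
  let g : RN N ≃L[ℝ] RN N := ContinuousLinearEquiv.smulLeft (Units.mk0 c hc)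
  have h2 := g.iteratedFDerivWithin_comp_right f (uniqueDiffOn_univ) (x := x - a) (mem_univ _) i
  rw [preimage_univ, iteratedFDerivWithin_univ, iteratedFDerivWithin_univ] at h2
  have hg : ∀ y, g y = c • y := fun y => rfl
  have h3 : (fun z => f (c • z)) = f ∘ g := rfl
  rw [h3, h2]
  ext m
  simp only [ContinuousMultilinearMap.compContinuousLinearMap_apply, hg,
    ContinuousLinearEquiv.coe_coe, smul_apply, smul_eq_mul]
  have := (iteratedFDeriv ℝ i f (c • (x - a))).map_smul_univ (fun _ => c) m
  simpa using this

theorem iterate_laplacian_comp_affine {n : ℕ} {f : RN N → ℝ} {c : ℝ} (hc : c ≠ 0) (a x : RN N)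
    (hf : ContDiffAt ℝ ((2 * n : ℕ) : WithTop ℕ∞) f (c • (x - a))) :
    (Laplacian.laplacian^[n] (fun z => f (c • (z - a)))) x =
      c ^ (2 * n) * (Laplacian.laplacian^[n] f) (c • (x - a)) := by
  obtain ⟨Λ, h⟩ := exists_iterate_laplacian_eq_clm N n
  have hcf : ContDiffAt ℝ ((2 * n : ℕ) : WithTop ℕ∞) (fun z => f (c • (z - a))) x :=
    hf.comp x (f := fun z => c • (z - a)) (by fun_prop)
  rw [h _ _ hf, h _ _ hcf, iteratedFDeriv_comp_affine _ hc, map_smul, smul_eq_mul]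

/-! ### Green's identity -/

theorem integrable_mul_of_tsupport {f ψ : RN N → ℝ} (hψ : Continuous ψ) (hc : HasCompactSupport ψ)
    (hf : ∀ x ∈ tsupport ψ, ContinuousAt f x) : Integrable (fun x => f x * ψ x) := by
  refine Continuous.integrable_of_hasCompactSupport ?_ hc.mul_left
  refine continuous_of_tsupport fun x hx => ?_
  exact (hf x (tsupport_mul_subset_right hx)).mul hψ.continuousAt

/-- Two integrations by parts in each coordinate direction. Every product contains `ψ` or one of its
derivatives, so `f` may be arbitrary off the support of `ψ`. -/
theorem integral_mul_laplacian_eq {f ψ : RN N → ℝ} (hψ : ContDiff ℝ ∞ ψ) (hc : HasCompactSupport ψ)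
    (hf : ∀ x ∈ tsupport ψ, ContDiffAt ℝ 2 f x) :
    ∫ x, f x * Laplacian.laplacian ψ x = ∫ x, Laplacian.laplacian f x * ψ x := by
  have hψ1 (e : RN N) : ContDiff ℝ ∞ (fun x => fderiv ℝ ψ x e) :=
    (hψ.fderiv_right (m := ∞) (by simp)).clm_apply contDiff_const
  have hs1 (e : RN N) : tsupport (fun x => fderiv ℝ ψ x e) ⊆ tsupport ψ :=
    tsupport_fderiv_apply_subset ℝ e
  have hc1 (e : RN N) : HasCompactSupport (fun x => fderiv ℝ ψ x e) :=
    hc.of_isClosed_subset isClosed_closure (hs1 e)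
  have hψ2 (e : RN N) : ContDiff ℝ ∞ (fun x => fderiv ℝ (fun x => fderiv ℝ ψ x e) x e) :=
    ((hψ1 e).fderiv_right (m := ∞) (by simp)).clm_apply contDiff_const
  have hs2 (e : RN N) : tsupport (fun x => fderiv ℝ (fun x => fderiv ℝ ψ x e) x e) ⊆ tsupport ψ :=
    (tsupport_fderiv_apply_subset ℝ e).trans (hs1 e)
  have hc2 (e : RN N) : HasCompactSupport (fun x => fderiv ℝ (fun x => fderiv ℝ ψ x e) x e) :=
    hc.of_isClosed_subset isClosed_closure (hs2 e)
  have hf1 (e : RN N) : ∀ x ∈ tsupport ψ, ContDiffAt ℝ 1 (fun x => fderiv ℝ f x e) x := fun x hx =>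
    ((hf x hx).fderiv_right (m := 1) (by norm_num)).clm_apply contDiffAt_const
  have hf2 (e : RN N) : ∀ x ∈ tsupport ψ,
      ContDiffAt ℝ 0 (fun x => fderiv ℝ (fun x => fderiv ℝ f x e) x e) x := fun x hx =>
    ((hf1 e x hx).fderiv_right (m := 0) (by norm_num)).clm_apply contDiffAt_const
  have hi2 (e : RN N) : Integrable
      (fun x => f x * fderiv ℝ (fun x => fderiv ℝ ψ x e) x e) :=
    integrable_mul_of_tsupport (hψ2 e).continuous (hc2 e) fun x hx =>
      (hf x (hs2 e hx)).continuousAt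
  have hi1 (e : RN N) : Integrable (fun x => fderiv ℝ f x e * fderiv ℝ ψ x e) :=
    integrable_mul_of_tsupport (hψ1 e).continuous (hc1 e) fun x hx =>
      (hf1 e x (hs1 e hx)).continuousAt
  have hi0 (e : RN N) : Integrable
      (fun x => fderiv ℝ (fun x => fderiv ℝ f x e) x e * ψ x) :=
    integrable_mul_of_tsupport hψ.continuous hc fun x hx => (hf2 e x hx).continuousAt
  have key (e : RN N) : ∫ x, f x * fderiv ℝ (fun x => fderiv ℝ ψ x e) x e =
      ∫ x, fderiv ℝ (fun x => fderiv ℝ f x e) x e * ψ x := by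
    rw [integral_mul_fderiv_eq_neg_fderiv_mul_of_integrable (hi1 e) (hi2 e)
        (integrable_mul_of_tsupport (hψ1 e).continuous (hc1 e) fun x hx =>
          (hf x (hs1 e hx)).continuousAt)
        (fun x hx => (hf x (hs1 e hx)).differentiableAt (by norm_num))
        (fun x _ => ((hψ1 e).differentiable (by simp)).differentiableAt),
      integral_mul_fderiv_eq_neg_fderiv_mul_of_integrable (hi0 e) (hi1 e)
        (integrable_mul_of_tsupport hψ.continuous hc fun x hx => (hf1 e x hx).continuousAt)
        (fun x hx => (hf1 e x hx).differentiableAt (by norm_num))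
        (fun x _ => (hψ.differentiable (by simp)).differentiableAt), neg_neg]
  have hLψ (x : RN N) : f x * Laplacian.laplacian ψ x = ∑ i : Fin N,
      f x * fderiv ℝ (fun x => fderiv ℝ ψ x (EuclideanSpace.single i 1)) x
        (EuclideanSpace.single i 1) := by
    rw [laplacian_eq_sum_fderiv, Finset.mul_sum]
    refine Finset.sum_congr rfl fun i _ => ?_
    have hd : DifferentiableAt ℝ (fderiv ℝ ψ) x :=
      (hψ.fderiv_right (m := 1) (by norm_cast)).differentiable (by norm_num) x
    rw [(hd.hasFDerivAt.clm_apply (hasFDerivAt_const _ x)).fderiv]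
    simp
  have hLf (x : RN N) : Laplacian.laplacian f x * ψ x = ∑ i : Fin N,
      fderiv ℝ (fun x => fderiv ℝ f x (EuclideanSpace.single i 1)) x
        (EuclideanSpace.single i 1) * ψ x := by
    by_cases hx : x ∈ tsupport ψ
    · rw [laplacian_eq_sum_fderiv, Finset.sum_mul]
      refine Finset.sum_congr rfl fun i _ => ?_
      have hd : DifferentiableAt ℝ (fderiv ℝ f) x :=
        ((hf x hx).fderiv_right (m := 1) (by norm_num)).differentiableAt (by norm_num)
      rw [(hd.hasFDerivAt.clm_apply (hasFDerivAt_const _ x)).fderiv]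
      simp
    · simp [image_eq_zero_of_notMem_tsupport hx]
  simp_rw [hLψ, hLf]
  rw [integral_finsetSum _ fun i _ => hi2 _, integral_finsetSum _ fun i _ => hi0 _]
  exact Finset.sum_congr rfl fun i _ => key _

/-- Iterated Green identity against a test function: only regularity of `f` on the support of the
test function is needed. -/
theorem integral_mul_iterate_laplacian_eq {n : ℕ} {f φ : RN N → ℝ} (hφ : ContDiff ℝ ∞ φ)
    (hc : HasCompactSupport φ)
    (hf : ∀ x ∈ tsupport φ, ContDiffAt ℝ ((2 * n : ℕ) : WithTop ℕ∞) f x) :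
    ∫ x, f x * (Laplacian.laplacian^[n] φ) x = ∫ x, (Laplacian.laplacian^[n] f) x * φ x := by
  induction n generalizing f with
  | zero => simp
  | succ n ih =>
    rw [Function.iterate_succ_apply',
      integral_mul_laplacian_eq (hφ.iterate_laplacian n) (hc.iterate_laplacian n), ih]
    · rw [← Function.iterate_succ_apply]
    · intro x hx
      exact ContDiffAt.iterate_laplacian (n := 1) (k := 2 * n)
        ((hf x hx).of_le (by norm_cast; omega))
    · intro x hx
      exact (hf x (tsupport_iterate_laplacian_subset φ n hx)).of_le (by norm_cast; omega)

theorem integral_mul_classicalNegLapPow_eq {n : ℕ} {f φ : RN N → ℝ} (hφ : IsTestFun φ)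
    (hf : ∀ x ∈ tsupport φ, ContDiffAt ℝ ((2 * n : ℕ) : WithTop ℕ∞) f x) :
    ∫ x, f x * classicalNegLapPow n φ x = ∫ x, classicalNegLapPow n f x * φ x := by
  have h := integral_mul_iterate_laplacian_eq hφ.1 hφ.2 hf
  simp only [classicalNegLapPow]
  calc _ = (-1 : ℝ) ^ n * ∫ x, f x * (Laplacian.laplacian^[n] φ) x := by
        rw [← integral_const_mul]
        exact integral_congr_ae (.of_forall fun x => by ring)
    _ = _ := by
        rw [h, ← integral_const_mul]
        exact integral_congr_ae (.of_forall fun x => by ring)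

end LaplacianPowers

/-! ### Powers of the norm, their iterated Laplacians and their truncations. -/

section PowerKernel

variable {N : ℕ}

theorem natCast_le_infty (k : ℕ) : (k : WithTop ℕ∞) ≤ ∞ :=
  WithTop.coe_le_coe.2 (le_top : (k : ℕ∞) ≤ ⊤)

theorem contDiffAt_norm_rpow (q : ℝ) {k : WithTop ℕ∞} {y : RN N} (hy : y ≠ 0) :
    ContDiffAt ℝ k (fun z : RN N => ‖z‖ ^ q) y :=
  (contDiffAt_norm ℝ hy).rpow_const_of_ne (norm_ne_zero_iff.2 hy)

theorem hasFDerivAt_norm_rpow_of_ne (q : ℝ) {y : RN N} (hy : y ≠ 0) :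
    HasFDerivAt (fun z : RN N => ‖z‖ ^ q) ((q * ‖y‖ ^ (q - 2)) • innerSL ℝ y) y := by
  have hpos : 0 < ‖y‖ := norm_pos_iff.2 hy
  have h1 := (hasStrictFDerivAt_norm_sq y).hasFDerivAt.rpow_const (p := q / 2)
    (Or.inl (by positivity))
  have h2 : (fun z : RN N => (‖z‖ ^ 2) ^ (q / 2)) = fun z : RN N => ‖z‖ ^ q := by
    funext z
    rw [← Real.rpow_natCast, ← Real.rpow_mul (norm_nonneg z)]
    congr 1
    push_cast
    ring
  rw [h2] at h1
  refine h1.congr_fderiv ?_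
  rw [← Real.rpow_natCast, ← Real.rpow_mul (norm_nonneg y)]
  have h3 : ((2 : ℕ) : ℝ) * (q / 2 - 1) = q - 2 := by push_cast; ring
  rw [h3]
  ext v
  simp
  ring

theorem laplacian_norm_rpow (q : ℝ) {y : RN N} (hy : y ≠ 0) :
    Laplacian.laplacian (fun z : RN N => ‖z‖ ^ q) y = q * (q - 2 + N) * ‖y‖ ^ (q - 2) := by
  have hpos : 0 < ‖y‖ := norm_pos_iff.2 hy
  obtain ⟨L, hL⟩ : ∃ L : RN N →L[ℝ] RN N →L[ℝ] ℝ, ∀ a b, L a b = inner ℝ a b :=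
    ⟨innerSL ℝ, fun _ _ => rfl⟩
  have hev : fderiv ℝ (fun z : RN N => ‖z‖ ^ q) =ᶠ[𝓝 y]
      fun z => (q * ‖z‖ ^ (q - 2)) • L z := by
    filter_upwards [isOpen_compl_singleton.mem_nhds hy] with z hz
    rw [(hasFDerivAt_norm_rpow_of_ne q hz).fderiv]
    ext v
    simp [hL]
  have hd := ((hasFDerivAt_norm_rpow_of_ne (q - 2) hy).const_mul q).smul L.hasFDerivAt
  rw [laplacian_eq_sum_fderiv, hev.fderiv_eq]
  have hsq := EuclideanSpace.real_norm_sq_eq y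
  have hpow : ‖y‖ ^ (q - 2) = ‖y‖ ^ (q - 2 - 2) * ‖y‖ ^ 2 := by
    rw [← Real.rpow_natCast, ← Real.rpow_add hpos]
    congr 1
    push_cast
    ring
  have hterm (i : Fin N) : fderiv ℝ (fun z : RN N => (q * ‖z‖ ^ (q - 2)) • L z) y
      (EuclideanSpace.single i 1) (EuclideanSpace.single i 1) =
      q * ‖y‖ ^ (q - 2) + q * (q - 2) * ‖y‖ ^ (q - 2 - 2) * (y i) ^ 2 := by
    rw [HasFDerivAt.fderiv (f := fun z : RN N => (q * ‖z‖ ^ (q - 2)) • L z) hd]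
    simp [hL, EuclideanSpace.inner_single_right]
    ring
  rw [Finset.sum_congr rfl fun i _ => hterm i, Finset.sum_add_distrib,
    ← Finset.mul_sum (f := fun i => y i ^ 2), ← hsq, hpow]
  simp
  ring

/-- The constant in `Δ^n |y|^q = C |y|^{q-2n}`. -/
noncomputable def powLapConst (N n : ℕ) (q : ℝ) : ℝ :=
  ∏ i ∈ Finset.range n, (q - 2 * i) * (q - 2 * i - 2 + N)

theorem iterate_laplacian_norm_rpow (n : ℕ) (q : ℝ) {y : RN N} (hy : y ≠ 0) :
    (Laplacian.laplacian^[n] (fun z : RN N => ‖z‖ ^ q)) y =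
      powLapConst N n q * ‖y‖ ^ (q - 2 * n) := by
  induction n generalizing y with
  | zero => simp [powLapConst]
  | succ n ih =>
    rw [Function.iterate_succ_apply']
    have hev : (Laplacian.laplacian^[n] (fun z : RN N => ‖z‖ ^ q)) =ᶠ[𝓝 y]
        fun z => powLapConst N n q * ‖z‖ ^ (q - 2 * n) := by
      filter_upwards [isOpen_compl_singleton.mem_nhds hy] with z hz
      exact ih hz
    rw [(InnerProductSpace.laplacian_congr_nhds hev).eq_of_nhds]
    have h := iterate_laplacian_const_mul (n := 1) (powLapConst N n q)
      (contDiffAt_norm_rpow (q - 2 * n) (k := ((2 * 1 : ℕ) : WithTop ℕ∞)) hy)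
    simp only [Function.iterate_one] at h
    rw [h, laplacian_norm_rpow _ hy, powLapConst, powLapConst, Finset.prod_range_succ]
    have he : q - 2 * ((n + 1 : ℕ) : ℝ) = q - 2 * n - 2 := by push_cast; ring
    rw [he]
    ring

/-! ### Truncations of the kernel -/

/-- A smooth radial cutoff, equal to one on the unit ball and supported in the ball of radius two. -/
noncomputable def unitBump (N : ℕ) : ContDiffBump (0 : RN N) := ⟨1, 2, one_pos, one_lt_two⟩

theorem contDiffAt_truncated_kernel (q : ℝ) {y : RN N} (hy : y ≠ 0) {k : WithTop ℕ∞} (hk : k ≤ ∞) :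
    ContDiffAt ℝ k (fun z : RN N => ‖z‖ ^ q * unitBump N z) y :=
  (contDiffAt_norm_rpow q hy).mul ((unitBump N).contDiffAt.of_le hk)

/-- Inside the unit ball the exact power formula applies, outside the ball of radius two the
function vanishes, and the annulus between them is compact and avoids the singularity. -/
theorem exists_bound_iterate_laplacian_truncated_kernel (N n : ℕ) (q : ℝ) :
    ∃ C : ℝ, 0 ≤ C ∧ ∀ y : RN N, y ≠ 0 →
      |(Laplacian.laplacian^[n] (fun z : RN N => ‖z‖ ^ q * unitBump N z)) y| ≤
        C * ‖y‖ ^ (q - 2 * n) := by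
  set F := (Laplacian.laplacian^[n] (fun z : RN N => ‖z‖ ^ q * unitBump N z)) with hF
  let K : Set (RN N) := Metric.closedBall 0 2 ∩ (Metric.ball 0 1)ᶜ
  have hK : IsCompact K := (isCompact_closedBall 0 2).inter_right Metric.isOpen_ball.isClosed_compl
  have hK0 : ∀ y ∈ K, y ≠ 0 := by
    rintro y ⟨-, hy⟩ rfl
    simp at hy
  have hcont : ContinuousOn (fun y => F y / ‖y‖ ^ (q - 2 * n)) K := by
    intro y hy
    have h0 := hK0 y hy
    refine ContinuousAt.continuousWithinAt ?_
    refine ContinuousAt.div ?_ ?_ (Real.rpow_pos_of_pos (norm_pos_iff.2 h0) _).ne'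
    · exact ContDiffAt.continuousAt_iterate_laplacian
        (contDiffAt_truncated_kernel q h0 (natCast_le_infty _))
    · exact (contDiffAt_norm_rpow (k := 0) _ h0).continuousAt
  obtain ⟨C, hC⟩ := hK.exists_bound_of_continuousOn hcont
  refine ⟨max (max C 0) |powLapConst N n q|, by positivity, fun y hy => ?_⟩
  have hpos : 0 < ‖y‖ ^ (q - 2 * n) := Real.rpow_pos_of_pos (norm_pos_iff.2 hy) _
  by_cases h1 : ‖y‖ < 1
  · have hev : (fun z : RN N => ‖z‖ ^ q * unitBump N z) =ᶠ[𝓝 y] fun z => ‖z‖ ^ q := by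
      filter_upwards [Metric.isOpen_ball.mem_nhds (mem_ball_zero_iff.2 h1)] with z hz
      rw [(unitBump N).one_of_mem_closedBall (Metric.ball_subset_closedBall hz), mul_one]
    rw [hF, (iterate_laplacian_congr_nhds hev n).eq_of_nhds, iterate_laplacian_norm_rpow n q hy,
      abs_mul, abs_of_pos hpos]
    gcongr
    exact le_max_right _ _
  · by_cases h2 : 2 < ‖y‖
    -- Writing zero as a multiple of the power lets linearity settle every `n`, including `n = 0`.
    · have hev : (fun z : RN N => ‖z‖ ^ q * unitBump N z) =ᶠ[𝓝 y] fun z => 0 * ‖z‖ ^ q := by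
        filter_upwards [Metric.isClosed_closedBall.isOpen_compl.mem_nhds
          (show y ∈ (Metric.closedBall 0 2)ᶜ by simpa using h2)] with z hz
        rw [(unitBump N).zero_of_le_dist (by
          simp only [mem_compl_iff, Metric.mem_closedBall, not_le] at hz
          exact hz.le)]
        ring
      rw [hF, (iterate_laplacian_congr_nhds hev n).eq_of_nhds,
        iterate_laplacian_const_mul 0 (contDiffAt_norm_rpow q hy)]
      simp only [zero_mul, abs_zero]
      positivity
    · have := hC y ⟨by simpa using h2, by simpa using h1⟩
      rw [Real.norm_eq_abs, abs_div, abs_of_pos hpos, div_le_iff₀ hpos] at this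
      refine this.trans ?_
      gcongr
      exact (le_max_left _ _).trans (le_max_left _ _)

/-- The kernel `|y|^q`, smoothly truncated near the origin and near infinity. -/
noncomputable def truncKernel (N : ℕ) (q R : ℝ) (y : RN N) : ℝ :=
  ‖y‖ ^ q * (unitBump N (R⁻¹ • y) - unitBump N (R • y))

theorem abs_truncKernel_le (q R : ℝ) (y : RN N) : |truncKernel N q R y| ≤ ‖y‖ ^ q := by
  have h : 0 ≤ ‖y‖ ^ q := by positivity
  rw [truncKernel, abs_mul, abs_of_nonneg h]
  refine mul_le_of_le_one_right h ?_
  have h1 := (unitBump N).nonneg (x := R⁻¹ • y)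
  have h2 := (unitBump N).le_one (x := R⁻¹ • y)
  have h3 := (unitBump N).nonneg (x := R • y)
  have h4 := (unitBump N).le_one (x := R • y)
  rw [abs_le]
  constructor <;> linarith

/-- Both cutoffs equal one for `|y| < 1/R` and both vanish for `|y| > 2R`, so their difference
removes the singularity as well as the tail. -/
theorem isTestFun_truncKernel (q : ℝ) {R : ℝ} (hR : 1 ≤ R) : IsTestFun (truncKernel N q R) := by
  have hR0 : 0 < R := by linarith
  constructor
  · rw [contDiff_iff_contDiffAt]
    intro y
    by_cases hy : y = 0
    · subst hy
      have hev : truncKernel N q R =ᶠ[𝓝 0] fun _ => 0 := by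
        filter_upwards [Metric.ball_mem_nhds (0 : RN N) (inv_pos.2 hR0)] with z hz
        have hz' : ‖z‖ < R⁻¹ := by simpa using hz
        have hz1 : ‖z‖ < 1 := hz'.trans_le (inv_le_one_of_one_le₀ hR)
        rw [truncKernel, (unitBump N).one_of_mem_closedBall, (unitBump N).one_of_mem_closedBall,
          sub_self, mul_zero]
        · rw [mem_closedBall_zero_iff, norm_smul, Real.norm_of_nonneg hR0.le]
          have := mul_le_mul_of_nonneg_left hz'.le hR0.le
          rwa [mul_inv_cancel₀ hR0.ne'] at this
        · rw [mem_closedBall_zero_iff, norm_smul, norm_inv, Real.norm_of_nonneg hR0.le]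
          exact mul_le_one₀ (inv_le_one_of_one_le₀ hR) (norm_nonneg _) hz1.le
      exact contDiffAt_const.congr_of_eventuallyEq hev
    · refine (contDiffAt_norm_rpow q hy).mul (ContDiffAt.sub ?_ ?_)
      · exact ((unitBump N).contDiff.comp (contDiff_const_smul R⁻¹)).contDiffAt
      · exact ((unitBump N).contDiff.comp (contDiff_const_smul R)).contDiffAt
  · refine HasCompactSupport.intro (isCompact_closedBall (0 : RN N) (2 * R)) fun y hy => ?_
    have hy' : 2 * R < ‖y‖ := by simpa using hy
    rw [truncKernel, (unitBump N).zero_of_le_dist, (unitBump N).zero_of_le_dist, sub_self, mul_zero]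
    · rw [dist_zero_right, norm_smul, Real.norm_of_nonneg hR0.le]
      change 2 ≤ _
      nlinarith
    · rw [dist_zero_right, norm_smul, norm_inv, Real.norm_of_nonneg hR0.le]
      change 2 ≤ _
      rw [inv_mul_eq_div, le_div_iff₀ hR0]
      exact hy'.le

/-- Equality on a neighbourhood, and not only at `y`, passes to all derivatives; the limit of the
iterated Laplacians is therefore eventually attained. -/
theorem truncKernel_eventuallyEq (q : ℝ) {y : RN N} (hy : y ≠ 0) :
    ∀ᶠ R : ℝ in atTop, truncKernel N q R =ᶠ[𝓝 y] fun z => ‖z‖ ^ q := by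
  have hpos : 0 < ‖y‖ := norm_pos_iff.2 hy
  -- For `‖y‖/2 < ‖z‖ < 2‖y‖`, the bound `2‖y‖ ≤ R` puts `R⁻¹ • z` in the unit ball and `4/‖y‖ ≤ R`
  -- puts `R • z` outside the ball of radius two.
  filter_upwards [eventually_ge_atTop (max 1 (max (2 * ‖y‖) (4 / ‖y‖)))] with R hR
  have hR1 : 1 ≤ R := (le_max_left _ _).trans hR
  have hR2 : 2 * ‖y‖ ≤ R := (le_max_left _ _).trans ((le_max_right _ _).trans hR)
  have hR3 : 4 / ‖y‖ ≤ R := (le_max_right _ _).trans ((le_max_right _ _).trans hR)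
  have hR0 : 0 < R := by linarith
  rw [div_le_iff₀ hpos] at hR3
  have hcont : Tendsto (fun z : RN N => ‖z‖) (𝓝 y) (𝓝 ‖y‖) := continuous_norm.continuousAt
  filter_upwards [hcont.eventually (lt_mem_nhds (show ‖y‖ / 2 < ‖y‖ by linarith)),
    hcont.eventually (gt_mem_nhds (show ‖y‖ < 2 * ‖y‖ by linarith))] with z hz1 hz2
  rw [truncKernel, (unitBump N).one_of_mem_closedBall, (unitBump N).zero_of_le_dist, sub_zero,
    mul_one]
  · rw [dist_zero_right, norm_smul, Real.norm_of_nonneg hR0.le]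
    change 2 ≤ _
    nlinarith
  · rw [mem_closedBall_zero_iff, norm_smul, norm_inv, Real.norm_of_nonneg hR0.le]
    change _ ≤ 1
    rw [inv_mul_eq_div, div_le_one hR0]
    linarith

theorem tendsto_truncKernel (q : ℝ) {y : RN N} (hy : y ≠ 0) :
    Tendsto (fun R => truncKernel N q R y) atTop (𝓝 (‖y‖ ^ q)) :=
  tendsto_const_nhds.congr' ((truncKernel_eventuallyEq q hy).mono fun _ h => h.eq_of_nhds.symm)

theorem tendsto_iterate_laplacian_truncKernel (n : ℕ) (q : ℝ) {y : RN N} (hy : y ≠ 0) :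
    Tendsto (fun R => (Laplacian.laplacian^[n] (truncKernel N q R)) y) atTop
      (𝓝 (powLapConst N n q * ‖y‖ ^ (q - 2 * n))) := by
  refine tendsto_const_nhds.congr' ((truncKernel_eventuallyEq q hy).mono fun _ h => ?_)
  exact ((iterate_laplacian_congr_nhds h n).eq_of_nhds.trans
    (iterate_laplacian_norm_rpow n q hy)).symm

/-- With `g(w) = |w|^q χ(w)`, where `χ` is the cutoff, `truncKernel` is a difference of two
functions `c^(-q) g(c y)`, for `c = R⁻¹` and `c = R`. The bound for `g` has exactly the homogeneity
that makes the powers of `c` cancel, whence the uniformity in `R`. -/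
theorem exists_bound_iterate_laplacian_truncKernel (N n : ℕ) (q : ℝ) :
    ∃ C : ℝ, ∀ R : ℝ, 1 ≤ R → ∀ y : RN N, y ≠ 0 →
      |(Laplacian.laplacian^[n] (truncKernel N q R)) y| ≤ C * ‖y‖ ^ (q - 2 * n) := by
  obtain ⟨C, hC0, hC⟩ := exists_bound_iterate_laplacian_truncated_kernel N n q
  have hscale (c : ℝ) (hc : 0 < c) (y : RN N) (hy : y ≠ 0) :
      |(Laplacian.laplacian^[n] (fun z : RN N => c ^ (-q) *
        (fun w : RN N => ‖w‖ ^ q * unitBump N w) (c • (z - 0)))) y| ≤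
        C * ‖y‖ ^ (q - 2 * n) := by
    have hcy : c • (y - 0) ≠ 0 := by simpa using ⟨hc.ne', hy⟩
    have hcd : ContDiffAt ℝ ((2 * n : ℕ) : WithTop ℕ∞)
        (fun w : RN N => ‖w‖ ^ q * unitBump N w) (c • (y - 0)) :=
      contDiffAt_truncated_kernel q hcy (natCast_le_infty _)
    have hcd' : ContDiffAt ℝ ((2 * n : ℕ) : WithTop ℕ∞)
        (fun z : RN N => (fun w : RN N => ‖w‖ ^ q * unitBump N w) (c • (z - 0))) y :=
      hcd.comp y (f := fun z => c • (z - 0)) (by fun_prop)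
    rw [iterate_laplacian_const_mul _ hcd',
      iterate_laplacian_comp_affine hc.ne' 0 y hcd, abs_mul, abs_mul,
      abs_of_nonneg (by positivity : 0 ≤ c ^ (-q)),
      abs_of_nonneg (by positivity : 0 ≤ c ^ (2 * n))]
    calc _ ≤ c ^ (-q) * (c ^ (2 * n) * (C * ‖c • (y - 0)‖ ^ (q - 2 * n))) := by
          gcongr
          exact hC _ hcy
      _ = C * ‖y‖ ^ (q - 2 * n) := by
          rw [sub_zero, norm_smul, Real.norm_of_nonneg hc.le,
            Real.mul_rpow hc.le (norm_nonneg _)]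
          have h1 : c ^ (-q) * c ^ (2 * n) * c ^ (q - 2 * n) = 1 := by
            rw [← Real.rpow_natCast, ← Real.rpow_add hc, ← Real.rpow_add hc]
            push_cast
            ring_nf
            exact Real.rpow_zero c
          linear_combination (C * ‖y‖ ^ (q - 2 * n)) * h1
  refine ⟨C + C, fun R hR y hy => ?_⟩
  have hR0 : 0 < R := by linarith
  have hRi : 0 < R⁻¹ := inv_pos.2 hR0
  have hcd (c : ℝ) (hc : 0 < c) : ContDiffAt ℝ ((2 * n : ℕ) : WithTop ℕ∞)
      (fun z : RN N => c ^ (-q) *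
        (fun w : RN N => ‖w‖ ^ q * unitBump N w) (c • (z - 0))) y := by
    have hcy : c • (y - 0) ≠ 0 := by simpa using ⟨hc.ne', hy⟩
    exact contDiffAt_const.mul ((contDiffAt_truncated_kernel q hcy
      (natCast_le_infty _)).comp y (f := fun z => c • (z - 0)) (by fun_prop))
  have heq : truncKernel N q R = (fun z : RN N => R⁻¹ ^ (-q) *
        (fun w : RN N => ‖w‖ ^ q * unitBump N w) (R⁻¹ • (z - 0))) -
      (fun z : RN N => R ^ (-q) * (fun w : RN N => ‖w‖ ^ q * unitBump N w) (R • (z - 0))) := by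
    funext z
    have h (c : ℝ) (hc : 0 < c) : c ^ (-q) * c ^ q = 1 := by
      rw [← Real.rpow_add hc, neg_add_cancel, Real.rpow_zero]
    simp only [Pi.sub_apply, truncKernel, sub_zero, norm_smul, norm_inv, Real.norm_of_nonneg hR0.le]
    rw [Real.mul_rpow hRi.le (norm_nonneg _), Real.mul_rpow hR0.le (norm_nonneg _)]
    linear_combination (‖z‖ ^ q * unitBump N (R • z)) * h R hR0 -
      (‖z‖ ^ q * unitBump N (R⁻¹ • z)) * h R⁻¹ hRi
  rw [heq, iterate_laplacian_sub (hcd _ hRi) (hcd _ hR0), add_mul]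
  exact (abs_sub _ _).trans (add_le_add (hscale _ hRi y hy) (hscale _ hR0 y hy))

end PowerKernel

/-! ### Weak powers of the Laplacian: change of variables, existence and representatives. -/

section WeakIdentities

variable {N : ℕ}

theorem MeasureTheory.LocallyIntegrable.integrable_mul_of_hasCompactSupport {f g : RN N → ℝ}
    (hf : LocallyIntegrable f) (hg : Continuous g) (hc : HasCompactSupport g) :
    Integrable (fun x => f x * g x) := by
  simpa [mul_comm] using hf.integrable_smul_left_of_hasCompactSupport hg hc

theorem integral_comp_add_smul (F : RN N → ℝ) (x : RN N) (k : ℝ) :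
    ∫ y, F (x + k • y) = |(k ^ N)⁻¹| * ∫ z, F z := by
  rw [Measure.integral_comp_smul volume (fun z => F (x + z)) k, integral_add_left_eq_self,
    finrank_euclideanSpace_fin, smul_eq_mul]

theorem integrable_comp_add_smul {F : RN N → ℝ} (hF : Integrable F) (x : RN N) {k : ℝ}
    (hk : k ≠ 0) : Integrable (fun y => F (x + k • y)) :=
  (integrable_comp_smul_iff volume (fun z => F (x + z)) hk).2 (hF.comp_add_left x)

theorem IsTestFun.comp_affine {φ : RN N → ℝ} (hφ : IsTestFun φ) {c : ℝ} (hc : c ≠ 0) (a : RN N) :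
    IsTestFun (fun z => φ (c • (z - a))) := by
  constructor
  · exact hφ.1.comp (f := fun z => c • (z - a)) (by fun_prop)
  · exact hφ.2.comp_homeomorph
      ((Homeomorph.subRight a).trans (Homeomorph.smulOfNeZero c hc))

theorem IsTestFun.classicalNegLapPow {φ : RN N → ℝ} (hφ : IsTestFun φ) (n : ℕ) :
    IsTestFun (classicalNegLapPow n φ) :=
  ⟨contDiff_const.mul (hφ.1.iterate_laplacian n), (hφ.2.iterate_laplacian n).mul_left⟩

theorem IsTestFun.classicalNegLapPow_comp_affine {φ : RN N → ℝ} (hφ : IsTestFun φ) (n : ℕ) {c : ℝ}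
    (hc : c ≠ 0) (a x : RN N) :
    _root_.classicalNegLapPow n (fun z => φ (c • (z - a))) x =
      c ^ (2 * n) * _root_.classicalNegLapPow n φ (c • (x - a)) := by
  rw [_root_.classicalNegLapPow, _root_.classicalNegLapPow,
    iterate_laplacian_comp_affine hc a x (hφ.1.contDiffAt.of_le (natCast_le_infty _))]
  ring

theorem integrable_comp_add_smul_mul {f φ : RN N → ℝ} (hf : LocallyIntegrable f) (hφ : IsTestFun φ)
    (x : RN N) {k : ℝ} (hk : k ≠ 0) : Integrable (fun y => f (x + k • y) * φ y) := by
  have hψ := hφ.comp_affine (inv_ne_zero hk) x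
  have := integrable_comp_add_smul
    (hf.integrable_mul_of_hasCompactSupport hψ.1.continuous hψ.2) x hk
  simpa [smul_smul, hk] using this

/-- Change of variables in the weak formulation of `v = (-Δ)^n u`. -/
theorem HasWeakNegLapPow.integral_comp_add_smul {n : ℕ} {u v φ : RN N → ℝ}
    (h : HasWeakNegLapPow n u v) (hφ : IsTestFun φ) (x : RN N) {k : ℝ} (hk : k ≠ 0) :
    ∫ y, u (x + k • y) * classicalNegLapPow n φ y =
      k ^ (2 * n) * ∫ y, v (x + k • y) * φ y := by
  have hki := inv_ne_zero hk
  have h0 := h.2 _ (hφ.comp_affine hki x)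
  have h1 := _root_.integral_comp_add_smul
    (fun z => u z * classicalNegLapPow n (fun z => φ (k⁻¹ • (z - x))) z) x k
  have h2 := _root_.integral_comp_add_smul (fun z => v z * φ (k⁻¹ • (z - x))) x k
  rw [h0, ← h2] at h1
  simp only [hφ.classicalNegLapPow_comp_affine n hki, add_sub_cancel_left, smul_smul,
    inv_mul_cancel₀ hk, one_smul] at h1
  rw [← h1, ← integral_const_mul]
  refine integral_congr_ae (.of_forall fun y => ?_)
  have : k ^ (2 * n) * k⁻¹ ^ (2 * n) = 1 := by rw [← mul_pow, mul_inv_cancel₀ hk, one_pow]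
  simp only
  linear_combination (-(u (x + k • y) * classicalNegLapPow n φ y)) * this

theorem hasWeakNegLapPow_classicalNegLapPow {n : ℕ} {f : RN N → ℝ} (hf : ContDiff ℝ ∞ f) :
    HasWeakNegLapPow n f (classicalNegLapPow n f) := by
  constructor
  · exact (continuous_const.mul (hf.iterate_laplacian n).continuous).locallyIntegrable
  · intro φ hφ
    exact integral_mul_classicalNegLapPow_eq hφ fun x _ =>
      hf.contDiffAt.of_le (natCast_le_infty _)

/-- Green's identity against the constant `1`, which a positive power of the Laplacian annihilates.
It disposes of the central term `k = 0` of the difference. -/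
theorem integral_classicalNegLapPow_eq_zero {n : ℕ} (hn : n ≠ 0) {φ : RN N → ℝ}
    (hφ : IsTestFun φ) : ∫ y, classicalNegLapPow n φ y = 0 := by
  have h := (hasWeakNegLapPow_classicalNegLapPow (n := n)
    (contDiff_const (c := (1 : ℝ)) : ContDiff ℝ ∞ fun _ : RN N => (1 : ℝ))).2 φ hφ
  simpa [classicalNegLapPow, iterate_laplacian_const n hn] using h

/-- The expansion of `Δ^n` into partial derivatives is applied to the test function and transferred
to the weak partials of `u`; the order `2n` is even, so no sign appears. -/
theorem MemW1Loc.exists_hasWeakNegLapPow {n : ℕ} {u : RN N → ℝ} (hu : MemW1Loc (2 * n) u) :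
    ∃ v, HasWeakNegLapPow n u v := by
  obtain ⟨ι, _, α, hα⟩ := exists_iterate_laplacian_eq_sum N n
  choose g hg using fun i => hu.2 (2 * n) le_rfl (α i)
  refine ⟨fun x => (-1) ^ n * ∑ i, g i x, ?_, fun φ hφ => ?_⟩
  · have : LocallyIntegrable (fun x => ∑ i, g i x) :=
      locallyIntegrable_finsetSum Finset.univ fun i _ => (hg i).1
    exact this.smul ((-1 : ℝ) ^ n)
  · have hD (i : ι) : Integrable (fun x => u x * iteratedFDeriv ℝ (2 * n) φ x
        (fun j => EuclideanSpace.single (α i j) (1 : ℝ))) := by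
      refine hu.1.integrable_mul_of_hasCompactSupport ?_ ?_
      · have hc : Continuous (iteratedFDeriv ℝ (2 * n) φ) :=
          hφ.1.continuous_iteratedFDeriv (natCast_le_infty _)
        exact (ContinuousMultilinearMap.apply ℝ (fun _ : Fin (2 * n) => RN N) ℝ _).continuous.comp hc
      · exact (hφ.2.iteratedFDeriv (𝕜 := ℝ) (2 * n)).comp_left
          (g := fun M : ContinuousMultilinearMap ℝ (fun _ : Fin (2 * n) => RN N) ℝ =>
            M (fun j => EuclideanSpace.single (α i j) (1 : ℝ))) rfl
    have hg' (i : ι) : Integrable (fun x => g i x * φ x) :=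
      (hg i).1.integrable_mul_of_hasCompactSupport hφ.1.continuous hφ.2
    calc ∫ x, u x * classicalNegLapPow n φ x
        = ∫ x, (-1 : ℝ) ^ n * ∑ i, u x * iteratedFDeriv ℝ (2 * n) φ x
          (fun j => EuclideanSpace.single (α i j) (1 : ℝ)) := by
          refine integral_congr_ae (.of_forall fun x => ?_)
          simp only [classicalNegLapPow]
          rw [hα φ x (hφ.1.contDiffAt.of_le (natCast_le_infty _)), ← Finset.mul_sum]
          ring
      _ = (-1 : ℝ) ^ n * ∑ i, ∫ x, g i x * φ x := by
          rw [integral_const_mul, integral_finsetSum _ fun i _ => hD i]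
          simp_rw [fun i => (hg i).2 φ hφ, pow_mul, neg_one_sq, one_pow, one_mul]
      _ = _ := by
          rw [← integral_finsetSum _ fun i _ => hg' i, ← integral_const_mul]
          refine integral_congr_ae (.of_forall fun x => ?_)
          simp only [← Finset.sum_mul]
          ring

theorem HasWeakNegLapPow.congr_ae {n : ℕ} {u v w : RN N → ℝ} (h : HasWeakNegLapPow n u v)
    (hvw : v =ᵐ[volume] w) : HasWeakNegLapPow n u w := by
  refine ⟨h.1.congr hvw, fun φ hφ => (h.2 φ hφ).trans (integral_congr_ae ?_)⟩
  filter_upwards [hvw] with x hx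
  rw [hx]

/-- The function `negLapPow n u`, which takes the classical values wherever they exist, represents
the weak `(-Δ)^n u`. -/
theorem hasWeakNegLapPow_negLapPow {n : ℕ} {u : RN N → ℝ} (hu : ∃ v, HasWeakNegLapPow n u v) :
    HasWeakNegLapPow n u (negLapPow n u) := by
  have hw : HasWeakNegLapPow n u (weakNegLapPow n u) := by
    rw [weakNegLapPow, dif_pos hu]
    exact Classical.choose_spec hu
  refine hw.congr_ae ?_
  let O : Set (RN N) := {x | ContDiffAt ℝ ((2 * n : ℕ) : WithTop ℕ∞) u x}
  have hO : IsOpen O := isOpen_iff_mem_nhds.2 fun x hx => hx.eventually_nat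
  have hcont : ContinuousOn (classicalNegLapPow n u) O := fun x hx =>
    (continuousAt_const.mul
      (ContDiffAt.continuousAt_iterate_laplacian hx)).continuousWithinAt
  -- On the open set where `u` is locally `C^(2n)`, Green's identity shows that classical and weak
  -- values define the same functional on test functions supported there, so they agree almost
  -- everywhere in it.
  have hae := hO.ae_eq_zero_of_integral_contDiff_smul_eq_zero
    (f := fun x => classicalNegLapPow n u x - weakNegLapPow n u x) (μ := volume)
    ((hcont.locallyIntegrableOn hO.measurableSet).sub (hw.1.locallyIntegrableOn O)) (by
      intro g hg hgc hgO
      have hgt : IsTestFun g := ⟨hg, hgc⟩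
      have h1 : Integrable (fun x => classicalNegLapPow n u x * g x) :=
        integrable_mul_of_tsupport hg.continuous hgc fun x hx =>
          hcont.continuousAt (hO.mem_nhds (hgO hx))
      have h2 : Integrable (fun x => weakNegLapPow n u x * g x) :=
        hw.1.integrable_mul_of_hasCompactSupport hg.continuous hgc
      have h3 := integral_mul_classicalNegLapPow_eq (n := n) hgt fun x hx => hgO hx
      rw [hw.2 g hgt] at h3
      calc _ = ∫ x, (classicalNegLapPow n u x * g x - weakNegLapPow n u x * g x) := by
            refine integral_congr_ae (.of_forall fun x => ?_)
            simp only [smul_eq_mul]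
            ring
        _ = 0 := by rw [integral_sub h1 h2, h3, sub_self])
  filter_upwards [hae] with x hx
  unfold negLapPow
  split_ifs with hxO
  · exact (sub_eq_zero.1 (hx hxO)).symm
  · rfl

/-- Where `u` is not continuous in a neighbourhood of the point, `negLapPow 0 u` takes the value of
a chosen representative, so only equality almost everywhere can be expected. -/
theorem negLapPow_zero_ae_eq {u : RN N → ℝ} (hu : LocallyIntegrable u) :
    negLapPow 0 u =ᵐ[volume] u := by
  have h0 : HasWeakNegLapPow 0 u u := ⟨hu, fun φ _ => by simp [classicalNegLapPow]⟩
  have h := hasWeakNegLapPow_negLapPow ⟨u, h0⟩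
  refine ae_eq_of_integral_contDiff_smul_eq h.1 hu fun g hg hgc => ?_
  have := (h.2 g ⟨hg, hgc⟩).symm.trans (h0.2 g ⟨hg, hgc⟩)
  simpa [mul_comm] using this

end WeakIdentities

/-! ### Algebra of the central difference: symmetry, moments, action on the cosine. -/

section Coefficients

/-- The coefficients `(-1)^k (2m choose m-k)` of the central difference of order `2m`. -/
noncomputable def finDiffCoeff (m : ℕ) (k : ℤ) : ℝ :=
  (-1 : ℝ) ^ k * ((2 * m).choose ((m : ℤ) - k).toNat : ℝ)

theorem finDiffCoeff_natCast {m k : ℕ} (hk : k ≤ m) :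
    finDiffCoeff m k = (-1 : ℝ) ^ k * ((2 * m).choose (m - k) : ℝ) := by
  have : ((m : ℤ) - k).toNat = m - k := by omega
  rw [finDiffCoeff, this, zpow_natCast]

theorem finDiffCoeff_neg {m k : ℕ} (hk : k ≤ m) : finDiffCoeff m (-k) = finDiffCoeff m k := by
  have h1 : ((m : ℤ) - k).toNat = m - k := by omega
  have h2 : ((m : ℤ) - -k).toNat = 2 * m - (m - k) := by omega
  rw [finDiffCoeff, finDiffCoeff, h1, h2, Nat.choose_symm (by omega), zpow_neg, ← inv_zpow]
  norm_num

/-- Folding of a symmetric sum onto positive indices. -/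
theorem sum_finDiffCoeff_mul (m : ℕ) (F : ℤ → ℝ) :
    ∑ k ∈ Finset.Icc (-(m : ℤ)) m, finDiffCoeff m k * F k =
      finDiffCoeff m 0 * F 0 +
        ∑ k ∈ Finset.Icc 1 m, finDiffCoeff m k * (F k + F (-(k : ℤ))) := by
  have key : ∀ (G : ℤ → ℝ) (l : ℕ), ∑ k ∈ Finset.Icc (-(l : ℤ)) l, G k =
      G 0 + ∑ k ∈ Finset.Icc 1 l, (G k + G (-(k : ℤ))) := by
    intro G l
    induction l with
    | zero => simp
    | succ l ih =>
      have h : Finset.Icc (-((l + 1 : ℕ) : ℤ)) ((l + 1 : ℕ) : ℤ) =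
          insert (-((l + 1 : ℕ) : ℤ)) (insert ((l + 1 : ℕ) : ℤ) (Finset.Icc (-(l : ℤ)) l)) := by
        ext k
        simp only [Finset.mem_insert, Finset.mem_Icc]
        omega
      rw [h, Finset.sum_insert, Finset.sum_insert, ih, Finset.sum_Icc_succ_top (by omega)]
      · ring
      · simp
      · simp only [Finset.mem_insert, Finset.mem_Icc]
        omega
  rw [key]
  congr 1
  refine Finset.sum_congr rfl fun k hk => ?_
  rw [finDiffCoeff_neg (Finset.mem_Icc.1 hk).2]
  ring

/-- The substitution `j = m - k` gives the standard shape for iterated forward differences and for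
the binomial theorem. -/
theorem sum_finDiffCoeff_mul_eq_sum_range (m : ℕ) (F : ℤ → ℝ) :
    ∑ k ∈ Finset.Icc (-(m : ℤ)) m, finDiffCoeff m k * F k =
      (-1 : ℝ) ^ m * ∑ j ∈ Finset.range (2 * m + 1),
        (-1 : ℝ) ^ j * ((2 * m).choose j : ℝ) * F ((m : ℤ) - j) := by
  rw [Finset.mul_sum]
  refine Finset.sum_nbij' (fun k => ((m : ℤ) - k).toNat) (fun j => (m : ℤ) - j) ?_ ?_ ?_ ?_ ?_
  · intro k hk
    simp only [Finset.mem_Icc, Finset.mem_range] at *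
    omega
  · intro j hj
    simp only [Finset.mem_Icc, Finset.mem_range] at *
    omega
  · intro k hk
    simp only [Finset.mem_Icc] at *
    omega
  · intro j hj
    simp
  · intro k hk
    simp only [Finset.mem_Icc] at hk
    have h1 : (m : ℤ) - ((m : ℤ) - k).toNat = k := by omega
    rw [h1, finDiffCoeff]
    have h2 : (-1 : ℝ) ^ k = (-1) ^ m * (-1) ^ ((m : ℤ) - k).toNat := by
      have h3 : (((m : ℤ) - k).toNat : ℤ) = m - k := by omega
      rw [← zpow_natCast, ← zpow_natCast (-1 : ℝ) ((m : ℤ) - k).toNat, h3,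
        ← zpow_add₀ (by norm_num : (-1 : ℝ) ≠ 0)]
      have h4 : (m : ℤ) + (m - k) = 2 * (m - k) + k := by ring
      rw [h4, zpow_add₀ (by norm_num : (-1 : ℝ) ≠ 0), zpow_mul]
      norm_num
    rw [h2]
    ring

/-- The moments of order less than `2m` of the central difference vanish. -/
theorem sum_finDiffCoeff_mul_pow {m j : ℕ} (hj : j < 2 * m) :
    ∑ k ∈ Finset.Icc (-(m : ℤ)) m, finDiffCoeff m k * (k : ℝ) ^ j = 0 := by
  -- The central difference is a `2m`-fold forward difference with unit step started at `-m`, and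
  -- this annihilates powers below `2m`. Reversing the order of the nodes costs only the factor
  -- `(-1)^j`.
  have h0 := congrFun (fwdDiff_iter_pow_eq_zero_of_lt (R := ℝ) hj) (-(m : ℝ))
  rw [fwdDiff_iter_eq_sum_shift] at h0
  rw [sum_finDiffCoeff_mul_eq_sum_range m fun k => (k : ℝ) ^ j]
  have h1 : ∑ i ∈ Finset.range (2 * m + 1),
      (-1 : ℝ) ^ i * ((2 * m).choose i : ℝ) * (((m : ℤ) - (i : ℤ) : ℤ) : ℝ) ^ j =
      (-1 : ℝ) ^ j * ∑ i ∈ Finset.range (2 * m + 1),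
        ((-1 : ℤ) ^ (2 * m - i) * (2 * m).choose i) • (-(m : ℝ) + i • (1 : ℝ)) ^ j := by
    rw [Finset.mul_sum]
    refine Finset.sum_congr rfl fun i hi => ?_
    have hi' : i ≤ 2 * m := by simpa [Nat.lt_succ_iff] using hi
    have h2 : (-1 : ℝ) ^ (2 * m - i) = (-1) ^ i := by
      have h4 : (-1 : ℝ) ^ (2 * m - i) * (-1) ^ i = 1 := by
        rw [← pow_add, Nat.sub_add_cancel hi', Even.neg_one_pow (even_two_mul m)]
      have h5 : (-1 : ℝ) ^ i * (-1) ^ i = 1 := by rw [← mul_pow]; norm_num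
      linear_combination (-1 : ℝ) ^ i * h4 - (-1 : ℝ) ^ (2 * m - i) * h5
    have h3 : (((m : ℤ) - (i : ℤ) : ℤ) : ℝ) = (-1) * (-(m : ℝ) + i • (1 : ℝ)) := by
      push_cast
      rw [nsmul_eq_mul]
      ring
    rw [h3, mul_pow, zsmul_eq_mul]
    push_cast
    rw [h2]
    ring
  rw [h1, h0]
  simp

/-- Real part of the binomial expansion of `(e^(it/2) - e^(-it/2))^(2m) = (2i sin(t/2))^(2m)`. The
resulting sign is what makes the normalizing sum nonzero. -/
theorem sum_finDiffCoeff_mul_cos (m : ℕ) (t : ℝ) :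
    ∑ k ∈ Finset.Icc (-(m : ℤ)) m, finDiffCoeff m k * Real.cos (k * t) =
      (4 * Real.sin (t / 2) ^ 2) ^ m := by
  rw [sum_finDiffCoeff_mul_eq_sum_range m fun k => Real.cos (k * t)]
  have h : ((∑ j ∈ Finset.range (2 * m + 1), (-1 : ℝ) ^ j * ((2 * m).choose j : ℝ) *
      Real.cos (((m : ℤ) - (j : ℤ) : ℤ) * t) : ℝ)) =
      (∑ j ∈ Finset.range (2 * m + 1), (-1 : ℂ) ^ j * ((2 * m).choose j : ℂ) *
        Complex.exp (((m : ℂ) - j) * t * Complex.I)).re := by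
    rw [Complex.re_sum]
    refine Finset.sum_congr rfl fun j _ => ?_
    have h1 : (-1 : ℂ) ^ j * ((2 * m).choose j : ℂ) =
        (((-1 : ℝ) ^ j * ((2 * m).choose j : ℝ) : ℝ) : ℂ) := by push_cast; ring
    have h2 : ((m : ℂ) - j) * t = (((m : ℝ) - j) * t : ℝ) := by push_cast; ring
    rw [h1, Complex.re_ofReal_mul, h2, Complex.exp_ofReal_mul_I_re]
    push_cast
    ring
  have h2 : ∑ j ∈ Finset.range (2 * m + 1), (-1 : ℂ) ^ j * ((2 * m).choose j : ℂ) *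
      Complex.exp (((m : ℂ) - j) * t * Complex.I) =
      (((2 * Real.sin (t / 2)) ^ (2 * m) * (-1) ^ m : ℝ) : ℂ) := by
    have h3 : (((2 * Real.sin (t / 2)) ^ (2 * m) * (-1) ^ m : ℝ) : ℂ) =
        (-Complex.exp (-(t / 2 : ℂ) * Complex.I) + Complex.exp ((t / 2 : ℂ) * Complex.I)) ^
          (2 * m) := by
      have h4 : -Complex.exp (-(t / 2 : ℂ) * Complex.I) + Complex.exp ((t / 2 : ℂ) * Complex.I) =
          2 * Complex.sin (t / 2) * Complex.I := by
        rw [Complex.sin]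
        linear_combination (-(Complex.exp (-(t / 2 : ℂ) * Complex.I) -
          Complex.exp ((t / 2 : ℂ) * Complex.I))) * Complex.I_sq
      rw [h4, mul_pow _ Complex.I, pow_mul Complex.I, Complex.I_sq]
      push_cast
      ring
    rw [h3, add_pow]
    refine Finset.sum_congr rfl fun j hj => ?_
    have hj' : j ≤ 2 * m := by simpa [Nat.lt_succ_iff] using hj
    rw [neg_pow (Complex.exp _), ← Complex.exp_nat_mul, ← Complex.exp_nat_mul]
    have h5 : Complex.exp (((m : ℂ) - j) * t * Complex.I) =
        Complex.exp (j * (-(t / 2 : ℂ) * Complex.I)) *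
          Complex.exp (((2 * m - j : ℕ) : ℂ) * ((t / 2 : ℂ) * Complex.I)) := by
      rw [← Complex.exp_add]
      congr 1
      push_cast [Nat.cast_sub hj']
      ring
    rw [h5]
    ring
  rw [h, h2, Complex.ofReal_re, pow_mul]
  have h6 : (-1 : ℝ) ^ m * (-1) ^ m = 1 := by rw [← mul_pow]; norm_num
  have h7 : (2 * Real.sin (t / 2)) ^ 2 = 4 * Real.sin (t / 2) ^ 2 := by ring
  rw [h7]
  linear_combination ((4 * Real.sin (t / 2) ^ 2) ^ m) * h6

theorem finDiff_eq_sum {N : ℕ} (m : ℕ) (u : RN N → ℝ) (x y : RN N) :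
    finDiff m u x y =
      ∑ k ∈ Finset.Icc (-(m : ℤ)) m, finDiffCoeff m k * u (x + (k : ℝ) • y) := rfl

theorem finDiff_one {N : ℕ} (v : RN N → ℝ) (x y : RN N) :
    finDiff 1 v x y = 2 * v x - v (x + y) - v (x - y) := by
  rw [finDiff_eq_sum, sum_finDiffCoeff_mul 1 fun k => v (x + (k : ℝ) • y)]
  have h0 : finDiffCoeff 1 0 = 2 := by simp [finDiffCoeff]
  have h1 : finDiffCoeff 1 1 = -1 := by simp [finDiffCoeff]
  simp [h0, h1, sub_eq_add_neg]
  ring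

/-- As the case `m = 1`, the fractional Laplacian shares the convergence proof of the hypersingular
integral. -/
theorem fracLapIntegrand_eq_hyperIntegrand {N : ℕ} (σ : ℝ) (v : RN N → ℝ) (x : RN N) :
    fracLapIntegrand σ v x = hyperIntegrand 1 σ v x := by
  funext y
  rw [fracLapIntegrand, hyperIntegrand, finDiff_one]

end Coefficients

/-! ### Taylor expansion and absolute convergence of the singular integrals. -/

section Integrability

variable {N : ℕ}

/-- Taylor expansion at a point of pointwise Hölder regularity. -/
theorem ContDiffPointwiseHolderAt.taylor_isBigO {k : ℕ} {α : unitInterval} {f : RN N → ℝ} {x : RN N}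
    (hf : ContDiffPointwiseHolderAt k α f x) :
    (fun y : RN N => f (x + y) - ∑ i ∈ Finset.range (k + 1),
      (i.factorial : ℝ)⁻¹ * iteratedFDeriv ℝ i f x (fun _ => y)) =O[𝓝 0]
      fun y => ‖y‖ ^ (k + (α : ℝ)) := by
  have hadd : Tendsto (fun y : RN N => x + y) (𝓝 0) (𝓝 x) := by
    have : Continuous (fun y : RN N => x + y) := by fun_prop
    simpa using this.tendsto 0
  rcases k with _ | l
  · have h := (ContDiffPointwiseHolderAt.zero_order_iff.1 hf).2.comp_tendsto hadd
    simpa [Function.comp_def] using h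
  · obtain ⟨C, hC0, hC⟩ := hf.isBigO.exists_pos
    have hC := hC.bound
    obtain ⟨r, hr, hball⟩ := Metric.eventually_nhds_iff_ball.1 (hC.and hf.contDiffAt.eventually_nat)
    refine Asymptotics.IsBigO.of_bound ((l.factorial : ℝ)⁻¹ * C) ?_
    filter_upwards [Metric.ball_mem_nhds (0 : RN N) hr] with y hy
    have hyr : ‖y‖ < r := by simpa using hy
    have hmem : ∀ t ∈ Icc (0 : ℝ) 1, x + t • y ∈ Metric.ball x r := by
      intro t ht
      rw [Metric.mem_ball, dist_eq_norm, add_sub_cancel_left, norm_smul, Real.norm_of_nonneg ht.1]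
      exact (mul_le_of_le_one_left (norm_nonneg _) ht.2).trans_lt hyr
    have htay := map_add_eq_sum_add_integral_iteratedFDeriv (f := f) (x := x) (y := y) (n := l)
      fun t ht => by exact_mod_cast (hball _ (hmem t ht)).2
    -- The top Taylor term is written as an integral against the same weight `(1 - t)^l`. The
    -- remainder then contains only the difference of the top derivatives at `x + t y` and `x`,
    -- which the Hölder condition controls.
    have hlast : (((l + 1).factorial : ℝ)⁻¹ * iteratedFDeriv ℝ (l + 1) f x fun _ => y) =
        (l.factorial : ℝ)⁻¹ •
          ∫ t in (0 : ℝ)..1, (1 - t) ^ l • iteratedFDeriv ℝ (l + 1) f x (fun _ => y) := by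
      have hi : ∫ t in (0 : ℝ)..1, (1 - t) ^ l = ((l : ℝ) + 1)⁻¹ := by
        rw [intervalIntegral.integral_comp_sub_left (fun t => t ^ l) 1]
        simp
      rw [intervalIntegral.integral_smul_const, hi, Nat.factorial_succ, smul_eq_mul, smul_eq_mul]
      push_cast
      rw [mul_inv]
      ring
    rw [htay, Finset.sum_range_succ _ (l + 1), hlast]
    simp only [smul_eq_mul]
    rw [add_sub_add_left_eq_sub, ← mul_sub]
    have hcont : ContinuousOn (fun t : ℝ => iteratedFDeriv ℝ (l + 1) f (x + t • y) fun _ => y)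
        (Icc 0 1) := by
      intro t ht
      have h1 : ContinuousAt (iteratedFDeriv ℝ (l + 1) f) (x + t • y) :=
        (hball _ (hmem t ht)).2.continuousAt_iteratedFDeriv le_rfl
      exact (h1.comp (x := t) (f := fun t : ℝ => x + t • y) (by fun_prop)).continuousWithinAt.eval_const _
    rw [← intervalIntegral.integral_sub]
    · rw [norm_mul, norm_inv, Real.norm_natCast, mul_assoc]
      refine mul_le_mul_of_nonneg_left ?_ (by positivity)
      have hb := intervalIntegral.norm_integral_le_of_norm_le_const (a := (0 : ℝ)) (b := 1)
        (C := C * ‖y‖ ^ ((l + 1 : ℕ) + (α : ℝ)))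
        (f := fun t => (1 - t) ^ l * (iteratedFDeriv ℝ (l + 1) f (x + t • y) fun _ => y) -
          (1 - t) ^ l * iteratedFDeriv ℝ (l + 1) f x fun _ => y) ?_
      · rw [Real.norm_of_nonneg (by positivity : 0 ≤ ‖y‖ ^ ((l + 1 : ℕ) + (α : ℝ)))]
        simpa using hb
      · intro t ht
        rw [uIoc_of_le zero_le_one] at ht
        have ht' : t ∈ Icc (0 : ℝ) 1 := ⟨ht.1.le, ht.2⟩
        have h1 := (hball _ (hmem t ht')).1
        rw [add_sub_cancel_left, norm_smul, Real.norm_of_nonneg ht'.1,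
          Real.norm_of_nonneg (by have := ht'.1; positivity : 0 ≤ (t * ‖y‖) ^ (α : ℝ))] at h1
        have h2 : ‖iteratedFDeriv ℝ (l + 1) f (x + t • y) - iteratedFDeriv ℝ (l + 1) f x‖ ≤
            C * ‖y‖ ^ (α : ℝ) := by
          refine h1.trans (mul_le_mul_of_nonneg_left ?_ hC0.le)
          exact Real.rpow_le_rpow (by have := ht'.1; positivity)
            (mul_le_of_le_one_left (norm_nonneg _) ht'.2) α.2.1
        have h3 : ‖(1 - t) ^ l‖ ≤ 1 := by
          rw [norm_pow, Real.norm_of_nonneg (by linarith [ht'.2])]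
          exact pow_le_one₀ (by linarith [ht'.2]) (by linarith [ht'.1])
        rw [← mul_sub, norm_mul]
        refine (mul_le_of_le_one_left (norm_nonneg _) h3).trans ?_
        have h4 := (iteratedFDeriv ℝ (l + 1) f (x + t • y) -
          iteratedFDeriv ℝ (l + 1) f x).le_opNorm (fun _ => y)
        rw [sub_apply] at h4
        refine h4.trans ?_
        rw [Finset.prod_const, Finset.card_univ, Fintype.card_fin]
        have h5 : ‖y‖ ^ ((l + 1 : ℕ) + (α : ℝ)) = ‖y‖ ^ (α : ℝ) * ‖y‖ ^ (l + 1) := by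
          rw [add_comm, Real.rpow_add_of_nonneg (norm_nonneg _) α.2.1 (by positivity),
            Real.rpow_natCast]
        rw [h5, ← mul_assoc]
        gcongr
    · refine ContinuousOn.intervalIntegrable ?_
      rw [uIcc_of_le zero_le_one]
      exact (by fun_prop : Continuous fun t : ℝ => (1 - t) ^ l).continuousOn.mul hcont
    · exact (by fun_prop : Continuous fun t : ℝ => (1 - t) ^ l *
        iteratedFDeriv ℝ (l + 1) f x fun _ => y).intervalIntegrable _ _

/-- The Taylor polynomial has degree `k < 2m` and is removed by the vanishing moments; what is left
is a finite combination of dilated remainders. -/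
theorem ContDiffPointwiseHolderAt.finDiff_isBigO {k m : ℕ} {α : unitInterval} {f : RN N → ℝ}
    {x : RN N} (hf : ContDiffPointwiseHolderAt k α f x) (hk : k < 2 * m) :
    (fun y : RN N => finDiff m f x y) =O[𝓝 0] fun y => ‖y‖ ^ (k + (α : ℝ)) := by
  set R : RN N → ℝ := fun y => f (x + y) - ∑ i ∈ Finset.range (k + 1),
      (i.factorial : ℝ)⁻¹ * iteratedFDeriv ℝ i f x (fun _ => y) with hR
  have hRO : R =O[𝓝 0] fun y => ‖y‖ ^ (k + (α : ℝ)) := hf.taylor_isBigO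
  have hα : 0 ≤ k + (α : ℝ) := add_nonneg (by positivity) α.2.1
  have heq : (fun y : RN N => finDiff m f x y) = fun y =>
      ∑ j ∈ Finset.Icc (-(m : ℤ)) m, finDiffCoeff m j * R ((j : ℝ) • y) := by
    funext y
    rw [finDiff_eq_sum]
    simp only [hR, mul_sub, Finset.sum_sub_distrib]
    rw [eq_comm, sub_eq_self]
    simp_rw [Finset.mul_sum]
    rw [Finset.sum_comm]
    refine Finset.sum_eq_zero fun i hi => ?_
    have hi' : i < 2 * m := by
      rw [Finset.mem_range] at hi
      omega
    have hhom (j : ℤ) : iteratedFDeriv ℝ i f x (fun _ => (j : ℝ) • y) =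
        (j : ℝ) ^ i * iteratedFDeriv ℝ i f x (fun _ => y) := by
      have := (iteratedFDeriv ℝ i f x).map_smul_univ (fun _ => (j : ℝ)) (fun _ => y)
      simpa using this
    calc _ = (∑ j ∈ Finset.Icc (-(m : ℤ)) m, finDiffCoeff m j * (j : ℝ) ^ i) *
          ((i.factorial : ℝ)⁻¹ * iteratedFDeriv ℝ i f x (fun _ => y)) := by
          rw [Finset.sum_mul]
          refine Finset.sum_congr rfl fun j _ => ?_
          rw [hhom]
          ring
      _ = 0 := by rw [sum_finDiffCoeff_mul_pow hi', zero_mul]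
  rw [heq]
  refine Asymptotics.IsBigO.fun_sum fun j _ => Asymptotics.IsBigO.const_mul_left ?_ _
  have ht : Tendsto (fun y : RN N => (j : ℝ) • y) (𝓝 0) (𝓝 0) := by
    have : Continuous (fun y : RN N => (j : ℝ) • y) := by fun_prop
    simpa using this.tendsto 0
  refine (hRO.comp_tendsto ht).trans ?_
  refine Asymptotics.IsBigO.of_bound (‖(j : ℝ)‖ ^ (k + (α : ℝ))) (.of_forall fun y => ?_)
  simp only [Function.comp_apply]
  rw [norm_smul, Real.mul_rpow (norm_nonneg _) (norm_nonneg _), norm_mul,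
    Real.norm_of_nonneg (by positivity : 0 ≤ ‖(j : ℝ)‖ ^ (k + (α : ℝ)))]

/-- If `f` is of class `C^{k,α}` at `x` with `k + α > 2s`, then its difference of order `2m > 2s`
is of order better than `2s`. -/
theorem ContDiffPointwiseHolderAt.exists_finDiff_isBigO {k m : ℕ} {α : unitInterval}
    {f : RN N → ℝ} {x : RN N} {s : ℝ} (hf : ContDiffPointwiseHolderAt k α f x)
    (hk : 2 * s < k + α) (hs : s < m) (hm : 0 < m) :
    ∃ a : ℝ, 2 * s < a ∧ (fun y : RN N => finDiff m f x y) =O[𝓝 0] fun y => ‖y‖ ^ a := by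
  by_cases h : k < 2 * m
  · exact ⟨_, hk, hf.finDiff_isBigO h⟩
  -- For `k ≥ 2m` regularity is given up down to `C^(2m-1,1)`: the moments vanish only below `2m`,
  -- and the exponent `2m` already exceeds `2s`.
  · refine ⟨_, ?_, (hf.of_order_lt (l := 2 * m - 1) (β := 1) (by omega)).finDiff_isBigO (by omega)⟩
    have : ((2 * m - 1 : ℕ) : ℝ) + ((1 : unitInterval) : ℝ) = 2 * m := by
      rw [Nat.cast_sub (by omega)]
      push_cast
      simp
    rw [this]
    linarith

theorem MemHolderLoc.contDiffPointwiseHolderAt {a : ℝ} {U : Set (RN N)} {u : RN N → ℝ}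
    (hu : MemHolderLoc a U u) (hU : IsOpen U) {x : RN N} (hx : x ∈ U) :
    ∃ (k : ℕ) (α : unitInterval), a = k + α ∧ 0 < (α : ℝ) ∧ ContDiffPointwiseHolderAt k α u x := by
  obtain ⟨k, τ, hτ0, hτ1, ha, hcd, hH⟩ := hu
  obtain ⟨V, hV, C, hC⟩ := hH x hx
  refine ⟨k, ⟨τ, hτ0.le, hτ1⟩, ha, hτ0, hcd.contDiffAt (hU.mem_nhds hx), ?_⟩
  refine Asymptotics.IsBigO.of_bound C ?_
  filter_upwards [hV] with y hy
  rw [Real.norm_of_nonneg (by positivity)]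
  exact hC y hy x (mem_of_mem_nhds hV)

/-- The operator `(-Δ)^n` lowers the order of regularity by `2n`. -/
theorem ContDiffPointwiseHolderAt.classicalNegLapPow {k n l : ℕ} {α : unitInterval} {u : RN N → ℝ}
    {x : RN N} (hu : ContDiffPointwiseHolderAt k α u x) (hl : l + 2 * n ≤ k) :
    ContDiffPointwiseHolderAt l α (classicalNegLapPow n u) x := by
  obtain ⟨Λ, h⟩ := exists_iterate_laplacian_eq_clm N n
  refine ((hu.iteratedFDeriv hl).continuousLinearMap_comp ((-1 : ℝ) ^ n • Λ)).congr_of_eventuallyEq ?_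
  filter_upwards [hu.contDiffAt.eventually_nat] with y hy
  simp only [Function.comp_apply, _root_.classicalNegLapPow]
  rw [h u y (hy.of_le (by norm_cast; omega))]
  simp

/-! ### Absolute convergence of the hypersingular integrals -/

theorem aestronglyMeasurable_comp_add_smul {f : RN N → ℝ} (hf : AEStronglyMeasurable f)
    (x : RN N) (k : ℝ) : AEStronglyMeasurable (fun y => f (x + k • y)) := by
  by_cases hk : k = 0
  · simpa [hk] using aestronglyMeasurable_const
  have h1 : AEStronglyMeasurable (fun z => f (x + z)) :=
    hf.comp_measurePreserving (measurePreserving_add_left volume x)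
  have h2 : AEStronglyMeasurable (fun z => f (x + z))
      (Measure.map (fun y : RN N => k • y) volume) := by
    rw [Measure.map_addHaar_smul volume hk]
    exact h1.smul_measure _
  exact h2.comp_measurable (by fun_prop)

theorem aestronglyMeasurable_hyperIntegrand {m : ℕ} {s : ℝ} {f : RN N → ℝ}
    (hf : AEStronglyMeasurable f) (x : RN N) : AEStronglyMeasurable (hyperIntegrand m s f x) := by
  have h1 : AEStronglyMeasurable (fun y => finDiff m f x y) := by
    simp only [finDiff_eq_sum]
    exact Finset.aestronglyMeasurable_fun_sum _ fun k _ =>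
      (aestronglyMeasurable_comp_add_smul hf x k).const_mul _
  have h2 : Measurable (fun y : RN N => ‖y‖ ^ ((N : ℝ) + 2 * s)) := by fun_prop
  have h3 := h1.mul h2.inv.aestronglyMeasurable
  exact h3.congr (.of_forall fun y => by simp [hyperIntegrand, div_eq_mul_inv])

theorem integrableOn_ball_norm_rpow (hN : 1 ≤ N) {b : ℝ} (hb : -(N : ℝ) < b) {r : ℝ} (hr : 0 < r) :
    IntegrableOn (fun y : RN N => ‖y‖ ^ b) (Metric.ball 0 r) := by
  have : NeZero N := ⟨by omega⟩
  have : Nontrivial (RN N) := inferInstance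
  rw [integrableOn_fun_norm_addHaar volume (f := fun t : ℝ => t ^ b)]
  have h : IntegrableOn (fun t : ℝ => t ^ ((N : ℝ) - 1 + b)) (Ioo 0 r) :=
    (intervalIntegral.integrableOn_Ioo_rpow_iff hr).2 (by linarith)
  refine h.congr_fun (fun t ht => ?_) measurableSet_Ioo
  rw [finrank_euclideanSpace_fin, smul_eq_mul, ← Real.rpow_natCast, ← Real.rpow_add ht.1,
    Nat.cast_sub hN, Nat.cast_one]

theorem integrable_one_div_one_add_norm_rpow {p : ℝ} (hp : (N : ℝ) < p) :
    Integrable (fun y : RN N => 1 / (1 + ‖y‖ ^ p)) := by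
  have h0 : 0 ≤ p := le_trans (by positivity) hp.le
  have h := (integrable_one_add_norm (E := RN N) (μ := volume) (r := p)
    (by rwa [finrank_euclideanSpace_fin])).const_mul (2 ^ p)
  have hmeas : Measurable (fun y : RN N => 1 + ‖y‖ ^ p) := by fun_prop
  refine h.mono' (hmeas.const_div 1).aestronglyMeasurable (.of_forall fun y => ?_)
  rw [Real.norm_of_nonneg (by positivity), Real.rpow_neg (by positivity), ← div_eq_mul_inv,
    div_le_div_iff₀ (by positivity) (by positivity), one_mul]
  have h2 : (1 + ‖y‖) ^ p ≤ (2 * max 1 ‖y‖) ^ p :=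
    Real.rpow_le_rpow (by positivity) (by linarith [le_max_left 1 ‖y‖, le_max_right 1 ‖y‖]) h0
  refine h2.trans ?_
  rw [Real.mul_rpow (by norm_num) (by positivity)]
  refine mul_le_mul_of_nonneg_left ?_ (by positivity)
  rcases max_cases 1 ‖y‖ with ⟨h, _⟩ | ⟨h, _⟩ <;> rw [h]
  · rw [Real.one_rpow]
    linarith [Real.rpow_nonneg (norm_nonneg y) p]
  · linarith

/-- Away from the origin `|y|^(N+2s)` dominates a multiple of the translated and dilated weight `1 +
|x + k y|^(N+2s)`, so each term of the difference is integrable separately. -/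
theorem MemL1Weight.integrableOn_compl_ball {s : ℝ} {f : RN N → ℝ} (hs : 0 < s)
    (hf : MemL1Weight s f) (x : RN N) (k : ℝ) {r : ℝ} (hr : 0 < r) :
    IntegrableOn (fun y => f (x + k • y) / ‖y‖ ^ ((N : ℝ) + 2 * s)) (Metric.ball 0 r)ᶜ := by
  set p := (N : ℝ) + 2 * s with hp
  have hp0 : 0 < p := by positivity
  have hpN : (N : ℝ) < p := by linarith
  have hmeas : AEStronglyMeasurable (fun y => f (x + k • y) / ‖y‖ ^ p) := by
    have h2 : Measurable (fun y : RN N => ‖y‖ ^ p) := by fun_prop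
    have h3 := (aestronglyMeasurable_comp_add_smul hf.1.aestronglyMeasurable x k).mul
      h2.inv.aestronglyMeasurable
    exact h3.congr (.of_forall fun y => by simp [div_eq_mul_inv])
  have hbound (z : RN N) (l : ℝ) : ∃ A : ℝ, ∀ y ∈ (Metric.ball (0 : RN N) r)ᶜ,
      1 + ‖z + l • y‖ ^ p ≤ A * ‖y‖ ^ p := by
    -- Both summands come from `‖y‖ ≥ r`: there `1 ≤ ‖y‖/r` and `‖z + l y‖ ≤ (‖z‖/r + |l|) ‖y‖`.
    refine ⟨r⁻¹ ^ p + (‖z‖ / r + |l|) ^ p, fun y hy => ?_⟩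
    have hy' : r ≤ ‖y‖ := by simpa using hy
    rw [add_mul, ← Real.mul_rpow (by positivity) (by positivity),
      ← Real.mul_rpow (by positivity) (by positivity)]
    refine add_le_add ?_ (Real.rpow_le_rpow (norm_nonneg _) ?_ hp0.le)
    · refine Real.one_le_rpow ?_ hp0.le
      rw [inv_mul_eq_div, one_le_div hr]
      exact hy'
    · refine (norm_add_le _ _).trans ?_
      rw [norm_smul, Real.norm_eq_abs, add_mul]
      refine add_le_add_left ?_ _
      rw [div_mul_eq_mul_div, le_div_iff₀ hr]
      exact mul_le_mul_of_nonneg_left hy' (norm_nonneg _)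
  have key (g : RN N → ℝ) (hg : Integrable g) (A : ℝ)
      (h : ∀ y ∈ (Metric.ball (0 : RN N) r)ᶜ, |f (x + k • y)| / ‖y‖ ^ p ≤ A * g y) :
      IntegrableOn (fun y => f (x + k • y) / ‖y‖ ^ p) (Metric.ball 0 r)ᶜ := by
    refine (hg.const_mul A).integrableOn.mono' hmeas.restrict ?_
    filter_upwards [ae_restrict_mem Metric.isOpen_ball.measurableSet.compl] with y hy
    rw [norm_div, Real.norm_eq_abs, Real.norm_of_nonneg (by positivity : 0 ≤ ‖y‖ ^ p)]
    exact h y hy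
  have hdiv (c B A D : ℝ) (hc : 0 ≤ c) (hB : 0 < B) (hD : 0 < D) (h : D ≤ A * B) :
      c / B ≤ A * (c / D) := by
    rw [← mul_div_assoc, div_le_div_iff₀ hB hD]
    nlinarith
  have hypos : ∀ y ∈ (Metric.ball (0 : RN N) r)ᶜ, 0 < ‖y‖ ^ p := fun y hy => by
    have hy' : r ≤ ‖y‖ := by simpa using hy
    exact Real.rpow_pos_of_pos (hr.trans_le hy') p
  by_cases hk : k = 0
  -- For `k = 0` the numerator is the constant `f x`, and integrability rests on `p > N` instead of
  -- the weight condition on `f`.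
  · obtain ⟨A, hA⟩ := hbound 0 1
    refine key _ ((integrable_one_div_one_add_norm_rpow hpN).const_mul |f x|) A fun y hy => ?_
    have := hA y hy
    rw [one_smul, zero_add] at this
    rw [hk, zero_smul, add_zero, mul_one_div]
    exact hdiv _ _ _ _ (abs_nonneg _) (hypos y hy) (by positivity) this
  · obtain ⟨A, hA⟩ := hbound x k
    refine key _ (integrable_comp_add_smul hf.2 x hk) A fun y hy => ?_
    exact hdiv _ _ _ _ (abs_nonneg _) (hypos y hy) (by positivity) (hA y hy)

/-- Near the origin the integrand is at most a multiple of `|y|^(a - N - 2s)`, integrable because `a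
> 2s`; outside a ball the difference is split into its terms. -/
theorem integrable_hyperIntegrand (hN : 1 ≤ N) {m : ℕ} {s a : ℝ} {f : RN N → ℝ} {x : RN N}
    (hs : 0 < s) (hf : MemL1Weight s f) (ha : 2 * s < a)
    (hO : (fun y : RN N => finDiff m f x y) =O[𝓝 0] fun y => ‖y‖ ^ a) :
    Integrable (hyperIntegrand m s f x) := by
  obtain ⟨C, hC⟩ := hO.bound
  obtain ⟨r, hr, hball⟩ := Metric.eventually_nhds_iff_ball.1 hC
  have hmeas := aestronglyMeasurable_hyperIntegrand (m := m) (s := s) hf.1.aestronglyMeasurable x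
  rw [← integrableOn_univ, ← union_compl_self (Metric.ball (0 : RN N) r), integrableOn_union]
  constructor
  · have hint := (integrableOn_ball_norm_rpow hN (b := a - ((N : ℝ) + 2 * s)) (by linarith)
      hr).const_mul C
    refine hint.mono' hmeas.restrict ?_
    have hne : ∀ᵐ y : RN N ∂(volume.restrict (Metric.ball 0 r)), y ≠ 0 := by
      have : NeZero N := ⟨by omega⟩
      have : Nontrivial (RN N) := inferInstance
      exact ae_restrict_of_ae (Measure.ae_ne volume 0)
    filter_upwards [ae_restrict_mem Metric.isOpen_ball.measurableSet, hne] with y hy hy0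
    have hpos : 0 < ‖y‖ := norm_pos_iff.2 hy0
    have h := hball y hy
    rw [Real.norm_of_nonneg (by positivity : 0 ≤ ‖y‖ ^ a)] at h
    rw [hyperIntegrand, norm_div, Real.norm_of_nonneg (by positivity : 0 ≤ ‖y‖ ^ ((N : ℝ) + 2 * s)),
      Real.rpow_sub hpos, ← mul_div_assoc]
    gcongr
  · have : hyperIntegrand m s f x = fun y => ∑ k ∈ Finset.Icc (-(m : ℤ)) m,
        finDiffCoeff m k * (f (x + (k : ℝ) • y) / ‖y‖ ^ ((N : ℝ) + 2 * s)) := by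
      funext y
      rw [hyperIntegrand, finDiff_eq_sum, Finset.sum_div]
      exact Finset.sum_congr rfl fun k _ => mul_div_assoc _ _ _
    rw [this]
    exact integrable_finsetSum _ fun k _ => (hf.integrableOn_compl_ball hs x k hr).const_mul _

end Integrability

/-! ### Transfer of the Laplacian powers to the kernel and passage to the limit. -/

section CoreIdentity

variable {N : ℕ}

theorem IsTestFun.integrable {φ : RN N → ℝ} (hφ : IsTestFun φ) : Integrable φ :=
  hφ.1.continuous.integrable_of_hasCompactSupport hφ.2

theorem IsTestFun.integrable_comp_add_smul_mul {f φ : RN N → ℝ} (hφ : IsTestFun φ)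
    (hf : LocallyIntegrable f) (x : RN N) (k : ℝ) :
    Integrable (fun y => f (x + k • y) * φ y) := by
  by_cases hk : k = 0
  · simpa [hk] using hφ.integrable.const_mul (f x)
  · exact _root_.integrable_comp_add_smul_mul hf hφ x hk

/-- The identity between the two difference operators tested against a smooth kernel. -/
theorem HasWeakNegLapPow.integral_finDiff_mul {m n : ℕ} (hnm : n < m) {u v φ : RN N → ℝ}
    (hu : LocallyIntegrable u) (h : HasWeakNegLapPow n u v) {x : RN N} (h0 : n = 0 → v x = u x)
    (hφ : IsTestFun φ) :
    ∫ y, finDiff m u x y * classicalNegLapPow n φ y =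
      -∑ k ∈ Finset.Icc 1 m, finDiffCoeff m k * (k : ℝ) ^ (2 * n) *
        ∫ y, (2 * v x - v (x + (k : ℝ) • y) - v (x - (k : ℝ) • y)) * φ y := by
  -- This is where `n < m` enters: the moment of order `2n` vanishes.
  have hcoef := sum_finDiffCoeff_mul_pow (m := m) (j := 2 * n) (by omega)
  rw [sum_finDiffCoeff_mul m fun k => (k : ℝ) ^ (2 * n)] at hcoef
  have hterm (k : ℤ) : ∫ y, u (x + (k : ℝ) • y) * classicalNegLapPow n φ y =
      (k : ℝ) ^ (2 * n) * ∫ y, v (x + (k : ℝ) • y) * φ y := by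
    -- The substitution is unavailable for `k = 0`. For `n > 0` both sides are zero; for `n = 0` the
    -- factor `0^0` is one and the claim needs the pointwise equality `v x = u x`.
    by_cases hk : k = 0
    · subst hk
      by_cases hn : n = 0
      · subst hn
        simp [classicalNegLapPow, h0 rfl]
      · simp only [Int.cast_zero, zero_smul, add_zero]
        rw [integral_const_mul, integral_classicalNegLapPow_eq_zero hn hφ, zero_pow (by omega)]
        simp
    · exact h.integral_comp_add_smul hφ x (by exact_mod_cast hk)
  calc ∫ y, finDiff m u x y * classicalNegLapPow n φ y
      = ∫ y, ∑ k ∈ Finset.Icc (-(m : ℤ)) m, finDiffCoeff m k *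
          (u (x + (k : ℝ) • y) * classicalNegLapPow n φ y) := by
        refine integral_congr_ae (.of_forall fun y => ?_)
        simp only [finDiff_eq_sum, Finset.sum_mul, mul_assoc]
    _ = ∑ k ∈ Finset.Icc (-(m : ℤ)) m, finDiffCoeff m k *
          ((k : ℝ) ^ (2 * n) * ∫ y, v (x + (k : ℝ) • y) * φ y) := by
        rw [integral_finsetSum _ fun (k : ℤ) _ =>
          ((hφ.classicalNegLapPow n).integrable_comp_add_smul_mul hu x (k : ℝ)).const_mul _]
        exact Finset.sum_congr rfl fun k _ => by rw [integral_const_mul, hterm]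
    _ = _ := by
        rw [sum_finDiffCoeff_mul m
          fun k => (k : ℝ) ^ (2 * n) * ∫ y, v (x + (k : ℝ) • y) * φ y]
        have hev (k : ℕ) : ((-(k : ℤ) : ℤ) : ℝ) ^ (2 * n) = (k : ℝ) ^ (2 * n) := by
          push_cast
          exact Even.neg_pow (even_two_mul n) _
        have hsplit (k : ℕ) : ∫ y, (2 * v x - v (x + (k : ℝ) • y) - v (x - (k : ℝ) • y)) * φ y =
            2 * v x * (∫ y, φ y) - (∫ y, v (x + (k : ℝ) • y) * φ y) -
              ∫ y, v (x + ((-(k : ℤ) : ℤ) : ℝ) • y) * φ y := by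
          have hi0 : Integrable (fun y => 2 * v x * φ y) := hφ.integrable.const_mul _
          have hi1 := hφ.integrable_comp_add_smul_mul h.1 x (k : ℝ)
          have hi2 := hφ.integrable_comp_add_smul_mul h.1 x ((-(k : ℤ) : ℤ) : ℝ)
          have hi3 : Integrable (fun y => 2 * v x * φ y - v (x + (k : ℝ) • y) * φ y) :=
            hi0.sub hi1
          rw [← integral_const_mul, ← integral_sub hi0 hi1, ← integral_sub hi3 hi2]
          refine integral_congr_ae (.of_forall fun y => ?_)
          simp only [Int.cast_neg, Int.cast_natCast, neg_smul, ← sub_eq_add_neg]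
          ring
        simp only [hev, hsplit, Int.cast_zero, zero_smul, add_zero, Int.cast_natCast,
          integral_const_mul] at hcoef ⊢
        -- The coefficient of the central term `v x` is exchanged for the sum over `k ≥ 1`, which
        -- completes each pair of translates to a second difference.
        have hc0 := eq_neg_of_add_eq_zero_left hcoef
        rw [← mul_assoc, hc0, neg_mul, Finset.sum_mul, ← Finset.sum_neg_distrib,
          ← Finset.sum_neg_distrib, ← Finset.sum_add_distrib]
        refine Finset.sum_congr rfl fun k _ => ?_
        ring

theorem ae_ne_zero (hN : 1 ≤ N) : ∀ᵐ y : RN N, y ≠ 0 := by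
  have : NeZero N := ⟨by omega⟩
  have : Nontrivial (RN N) := inferInstance
  exact Measure.ae_ne volume 0

theorem tendsto_integral_mul_truncKernel (hN : 1 ≤ N) {q : ℝ} {F : RN N → ℝ}
    (hF : AEStronglyMeasurable F) (hI : Integrable (fun y => F y * ‖y‖ ^ q)) :
    Tendsto (fun R => ∫ y, F y * truncKernel N q R y) atTop (𝓝 (∫ y, F y * ‖y‖ ^ q)) := by
  refine tendsto_integral_filter_of_dominated_convergence (fun y => ‖F y * ‖y‖ ^ q‖) ?_ ?_
    hI.norm ?_
  · filter_upwards [eventually_ge_atTop 1] with R hR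
    exact hF.mul (isTestFun_truncKernel q hR).1.continuous.aestronglyMeasurable
  · filter_upwards with R
    filter_upwards with y
    rw [norm_mul, norm_mul]
    refine mul_le_mul_of_nonneg_left ?_ (norm_nonneg _)
    rw [Real.norm_of_nonneg (by positivity : 0 ≤ ‖y‖ ^ q)]
    exact abs_truncKernel_le q R y
  · filter_upwards [ae_ne_zero hN] with y hy
    exact (tendsto_truncKernel q hy).const_mul _

/-- The bound uniform in `R` provides the dominating function, so integrability against the limiting
kernel suffices. -/
theorem tendsto_integral_mul_classicalNegLapPow_truncKernel (hN : 1 ≤ N) (n : ℕ) {q : ℝ}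
    {F : RN N → ℝ} (hF : AEStronglyMeasurable F)
    (hI : Integrable (fun y => F y * ‖y‖ ^ (q - 2 * n))) :
    Tendsto (fun R => ∫ y, F y * classicalNegLapPow n (truncKernel N q R) y) atTop
      (𝓝 ((-1) ^ n * powLapConst N n q * ∫ y, F y * ‖y‖ ^ (q - 2 * n))) := by
  obtain ⟨C, hC⟩ := exists_bound_iterate_laplacian_truncKernel N n q
  rw [← integral_const_mul]
  refine tendsto_integral_filter_of_dominated_convergence
    (fun y => C * ‖F y * ‖y‖ ^ (q - 2 * n)‖) ?_ ?_ (hI.norm.const_mul C) ?_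
  · filter_upwards [eventually_ge_atTop 1] with R hR
    exact hF.mul
      ((isTestFun_truncKernel q hR).classicalNegLapPow n).1.continuous.aestronglyMeasurable
  · filter_upwards [eventually_ge_atTop 1] with R hR
    filter_upwards [ae_ne_zero hN] with y hy
    rw [norm_mul, norm_mul, mul_left_comm]
    refine mul_le_mul_of_nonneg_left ?_ (norm_nonneg _)
    rw [Real.norm_of_nonneg (by positivity : 0 ≤ ‖y‖ ^ (q - 2 * n)), classicalNegLapPow, norm_mul,
      norm_pow, norm_neg, norm_one, one_pow, one_mul]
    exact hC R hR y hy
  · filter_upwards [ae_ne_zero hN] with y hy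
    have h := ((tendsto_iterate_laplacian_truncKernel n q hy).const_mul ((-1) ^ n)).const_mul (F y)
    rw [show (-1) ^ n * powLapConst N n q * (F y * ‖y‖ ^ (q - 2 * n)) =
      F y * ((-1) ^ n * (powLapConst N n q * ‖y‖ ^ (q - 2 * n))) by ring]
    exact h

/-- The sum in the normalizing constant of the hypersingular integral. -/
noncomputable def hyperSum (m : ℕ) (s : ℝ) : ℝ :=
  ∑ k ∈ Finset.Icc 1 m, (-1 : ℝ) ^ k * ((2 * m).choose (m - k) : ℝ) * (k : ℝ) ^ (2 * s)

/-- The relation between the two singular integrals, up to the explicit constants. -/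
theorem HasWeakNegLapPow.integral_hyperIntegrand (hN : 1 ≤ N) {m n : ℕ} (hnm : n < m) {σ : ℝ}
    {u v : RN N → ℝ} (hu : LocallyIntegrable u) (h : HasWeakNegLapPow n u v) {x : RN N}
    (h0 : n = 0 → v x = u x) (hI : Integrable (hyperIntegrand m (n + σ) u x))
    (hJ : Integrable (fracLapIntegrand σ v x)) :
    (-1) ^ n * powLapConst N n (-((N : ℝ) + 2 * σ)) * ∫ y, hyperIntegrand m (n + σ) u x y =
      -hyperSum m (n + σ) * ∫ y, fracLapIntegrand σ v x y := by
  -- The exponent of the fractional Laplacian kernel; subtracting `2n` gives the hypersingular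
  -- exponent `-(N + 2s)`.
  set q := -((N : ℝ) + 2 * σ) with hq
  have hrpow (c : ℝ) (y : RN N) (p : ℝ) : c * ‖y‖ ^ (-p) = c / ‖y‖ ^ p := by
    rw [Real.rpow_neg (norm_nonneg _), div_eq_mul_inv]
  have hqs : q - 2 * n = -((N : ℝ) + 2 * (n + σ)) := by rw [hq]; ring
  have hIeq : (fun y => finDiff m u x y * ‖y‖ ^ (q - 2 * n)) = hyperIntegrand m (n + σ) u x := by
    funext y
    rw [hqs, hrpow, hyperIntegrand]
  have hJeq (k : ℕ) (hk : 1 ≤ k) : (fun y : RN N =>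
      (2 * v x - v (x + (k : ℝ) • y) - v (x - (k : ℝ) • y)) * ‖y‖ ^ q) =
      fun y => (k : ℝ) ^ ((N : ℝ) + 2 * σ) * fracLapIntegrand σ v x ((k : ℝ) • y) := by
    funext y
    have hk0 : (0 : ℝ) < k := by exact_mod_cast hk
    rw [hq, hrpow, fracLapIntegrand, norm_smul, Real.norm_of_nonneg hk0.le,
      Real.mul_rpow hk0.le (norm_nonneg _), ← mul_div_assoc,
      mul_div_mul_left _ _ (Real.rpow_pos_of_pos hk0 _).ne']
  have hum := hu.aestronglyMeasurable
  have hvm := h.1.aestronglyMeasurable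
  have hfm : AEStronglyMeasurable (fun y => finDiff m u x y) := by
    simp only [finDiff_eq_sum]
    exact Finset.aestronglyMeasurable_fun_sum _ fun k _ =>
      (aestronglyMeasurable_comp_add_smul hum x k).const_mul _
  have hlim1 := tendsto_integral_mul_classicalNegLapPow_truncKernel hN n (q := q) hfm
    (by rw [hIeq]; exact hI)
  rw [hIeq] at hlim1
  -- Homogeneity of the kernel gives `k^(N+2σ)` and the Jacobian `k^(-N)`. The surviving `k^(2σ)`
  -- joins `k^(2n)` to form the `k^(2s)` of `hyperSum`.
  have hlim2 (k : ℕ) (hk : 1 ≤ k) : Tendsto (fun R => ∫ y : RN N,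
      (2 * v x - v (x + (k : ℝ) • y) - v (x - (k : ℝ) • y)) * truncKernel N q R y) atTop
      (𝓝 ((k : ℝ) ^ (2 * σ) * ∫ y, fracLapIntegrand σ v x y)) := by
    have hk0 : (0 : ℝ) < k := by exact_mod_cast hk
    have hm : AEStronglyMeasurable (fun y : RN N =>
        2 * v x - v (x + (k : ℝ) • y) - v (x - (k : ℝ) • y)) := by
      refine (aestronglyMeasurable_const.sub (aestronglyMeasurable_comp_add_smul hvm x k)).sub ?_
      simpa [sub_eq_add_neg] using aestronglyMeasurable_comp_add_smul hvm x (-(k : ℝ))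
    have hi : Integrable (fun y : RN N =>
        (2 * v x - v (x + (k : ℝ) • y) - v (x - (k : ℝ) • y)) * ‖y‖ ^ q) := by
      rw [hJeq k hk]
      exact ((integrable_comp_smul_iff volume _ hk0.ne').2 hJ).const_mul _
    convert tendsto_integral_mul_truncKernel hN hm hi using 2
    rw [hJeq k hk, integral_const_mul, Measure.integral_comp_smul volume _ (k : ℝ),
      finrank_euclideanSpace_fin, abs_of_pos (by positivity), smul_eq_mul, ← mul_assoc,
      Real.rpow_add hk0, Real.rpow_natCast]
    congr 1
    field_simp
  have hlim3 := (tendsto_finsetSum (Finset.Icc 1 m) fun k hk =>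
    (hlim2 k (Finset.mem_Icc.1 hk).1).const_mul (finDiffCoeff m k * (k : ℝ) ^ (2 * n))).neg
  have hlim1' := hlim1.congr' (by
    filter_upwards [eventually_ge_atTop 1] with R hR
    exact h.integral_finDiff_mul hnm hu h0 (isTestFun_truncKernel q hR))
  rw [tendsto_nhds_unique hlim1' hlim3, hyperSum, neg_mul, Finset.sum_mul]
  congr 1
  refine Finset.sum_congr rfl fun k hk => ?_
  obtain ⟨hk1, hkm⟩ := Finset.mem_Icc.1 hk
  have hk0 : (0 : ℝ) < k := by exact_mod_cast hk1
  have hpow : (k : ℝ) ^ (2 * ((n : ℝ) + σ)) = (k : ℝ) ^ (2 * n) * (k : ℝ) ^ (2 * σ) := by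
    rw [← Real.rpow_natCast, ← Real.rpow_add hk0]
    push_cast
    ring_nf
  rw [finDiffCoeff_natCast hkm, hpow]
  ring

end CoreIdentity

/-! ### Nonvanishing and matching of the constants; weighted spaces. -/

section NormalizingConstant

variable {N : ℕ}

/-- At the exponent `-(N + 2σ)` every factor of the product is negative. -/
theorem powLapConst_ne_zero (N n : ℕ) {σ : ℝ} (hσ : 0 < σ) :
    powLapConst N n (-((N : ℝ) + 2 * σ)) ≠ 0 := by
  refine Finset.prod_ne_zero_iff.2 fun i _ => mul_ne_zero ?_ ?_
  · have : (0 : ℝ) < N + 2 * σ + 2 * i := by positivity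
    exact ne_of_lt (by linarith)
  · have : (0 : ℝ) < 2 * σ + 2 * i := by positivity
    exact ne_of_lt (by linarith)

theorem measurable_one_add_norm_rpow (p : ℝ) : Measurable (fun y : RN N => 1 + ‖y‖ ^ p) := by
  fun_prop

theorem memL1Weight_of_bounded {s : ℝ} (hs : 0 < s) {f : RN N → ℝ} (hf : Continuous f) {C : ℝ}
    (hC : ∀ y, |f y| ≤ C) : MemL1Weight s f := by
  refine ⟨hf.locallyIntegrable, ?_⟩
  have h := (integrable_one_div_one_add_norm_rpow (N := N) (p := (N : ℝ) + 2 * s)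
    (by linarith)).const_mul C
  refine h.mono' (hf.abs.measurable.div (measurable_one_add_norm_rpow _)).aestronglyMeasurable
    (.of_forall fun y => ?_)
  rw [norm_div, Real.norm_eq_abs, abs_abs, Real.norm_of_nonneg (by positivity), mul_one_div]
  gcongr
  exact hC y

theorem memL1Weight_of_isTestFun (s : ℝ) {f : RN N → ℝ} (hf : IsTestFun f) : MemL1Weight s f := by
  refine ⟨hf.1.continuous.locallyIntegrable, ?_⟩
  refine hf.integrable.abs.mono'
    (hf.1.continuous.abs.measurable.div (measurable_one_add_norm_rpow _)).aestronglyMeasurable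
    (.of_forall fun y => ?_)
  rw [norm_div, Real.norm_eq_abs, abs_abs, Real.norm_of_nonneg (by positivity)]
  exact div_le_self (abs_nonneg _) (le_add_of_nonneg_right (by positivity))

theorem MemL1Weight.mono {s t : ℝ} (hs : 0 ≤ s) (hst : s ≤ t) {f : RN N → ℝ}
    (hf : MemL1Weight s f) : MemL1Weight t f := by
  refine ⟨hf.1, (hf.2.const_mul 2).mono'
    (hf.1.aestronglyMeasurable.norm.mul
      (measurable_one_add_norm_rpow _).inv.aestronglyMeasurable) (.of_forall fun y => ?_)⟩
  have h : 1 + ‖y‖ ^ ((N : ℝ) + 2 * s) ≤ 2 * (1 + ‖y‖ ^ ((N : ℝ) + 2 * t)) := by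
    have h0 : 0 ≤ ‖y‖ ^ ((N : ℝ) + 2 * t) := by positivity
    rcases le_total ‖y‖ 1 with h1 | h1
    · have := Real.rpow_le_one (norm_nonneg y) h1 (by positivity : 0 ≤ (N : ℝ) + 2 * s)
      linarith
    · have := Real.rpow_le_rpow_of_exponent_le h1 (by linarith : (N : ℝ) + 2 * s ≤ N + 2 * t)
      linarith
  rw [norm_div, Real.norm_eq_abs, abs_abs, Real.norm_of_nonneg (by positivity), ← mul_div_assoc,
    div_le_div_iff₀ (by positivity) (by positivity)]
  nlinarith [abs_nonneg (f y)]

theorem MemL1Weight.congr_ae {s : ℝ} {f g : RN N → ℝ} (hf : MemL1Weight s f)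
    (h : f =ᵐ[volume] g) : MemL1Weight s g := by
  refine ⟨hf.1.congr h, hf.2.congr ?_⟩
  filter_upwards [h] with y hy
  rw [hy]

theorem laplacian_cos_coord :
    Laplacian.laplacian (fun y : RN 1 => Real.cos (y 0)) = fun y => -1 * Real.cos (y 0) := by
  let P : RN 1 →L[ℝ] ℝ := EuclideanSpace.proj 0
  funext y
  have h1 : fderiv ℝ (fun y : RN 1 => Real.cos (y 0)) = fun y => (-Real.sin (P y)) • P := by
    funext z
    exact (P.hasFDerivAt (x := z)).cos.fderiv
  have h2 : HasFDerivAt (fun y : RN 1 => (-Real.sin (P y)) • P)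
      ((-(Real.cos (P y) • P)).smulRight P) y :=
    (P.hasFDerivAt (x := y)).sin.neg.smul_const P
  rw [laplacian_eq_sum_fderiv, h1, h2.fderiv]
  simp [P]

/-- The cosine is fixed by every power of `-Δ` on the line, so it can play the roles of both `u` and
`v` in the core identity. -/
theorem iterate_laplacian_cos_coord (n : ℕ) :
    (Laplacian.laplacian^[n] (fun y : RN 1 => Real.cos (y 0))) =
      fun y => (-1) ^ n * Real.cos (y 0) := by
  have hcd : ContDiff ℝ ∞ (fun y : RN 1 => Real.cos (y 0)) := by fun_prop
  induction n with
  | zero => simp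
  | succ n ih =>
    rw [Function.iterate_succ_apply', ih]
    funext y
    have h := iterate_laplacian_const_mul (n := 1) (x := y) ((-1) ^ n)
      (hcd.contDiffAt.of_le (natCast_le_infty _))
    rw [Function.iterate_one] at h
    rw [h, laplacian_cos_coord]
    ring

/-- The normalizing sum does not vanish for non-integer exponents in `(0, m)`. -/
theorem hyperSum_ne_zero {m n : ℕ} (hnm : n < m) {σ : ℝ} (hσ0 : 0 < σ) (hσ1 : σ < 1) :
    hyperSum m (n + σ) ≠ 0 := by
  intro hS
  -- The sum does not depend on the dimension, so it may be tested on the line. If it vanished, the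
  -- core identity would force the hypersingular integral of the cosine at `0` to vanish, although
  -- its integrand is nonnegative and not null.
  let u : RN 1 → ℝ := fun y => Real.cos (y 0)
  have hcd : ContDiff ℝ ∞ u := by fun_prop
  have hu1 : ∀ y, |u y| ≤ 1 := fun y => Real.abs_cos_le_one _
  have hs : 0 < (n : ℝ) + σ := by positivity
  have hnm' : (n : ℝ) + 1 ≤ m := by exact_mod_cast hnm
  have hLu : classicalNegLapPow n u = u := by
    funext y
    simp only [classicalNegLapPow, u]
    rw [iterate_laplacian_cos_coord, ← mul_assoc, ← mul_pow]
    norm_num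
  have hweak : HasWeakNegLapPow n u u := by
    have := hasWeakNegLapPow_classicalNegLapPow (n := n) hcd
    rwa [hLu] at this
  have hreg (l : ℕ) : ContDiffPointwiseHolderAt l 1 u 0 :=
    hcd.contDiffAt.contDiffPointwiseHolderAt
      (lt_of_lt_of_le (by exact_mod_cast Nat.lt_succ_self l) (natCast_le_infty (l + 1))) 1
  have hone : ((1 : unitInterval) : ℝ) = 1 := rfl
  obtain ⟨a, ha, hOa⟩ := (hreg (2 * m)).exists_finDiff_isBigO (m := m) (s := n + σ)
    (by rw [hone]; push_cast; linarith) (by linarith) (by omega)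
  have hI := integrable_hyperIntegrand le_rfl hs
    (memL1Weight_of_bounded hs hcd.continuous hu1) ha hOa
  obtain ⟨b, hb, hOb⟩ := (hreg 2).exists_finDiff_isBigO (m := 1) (s := σ)
    (by rw [hone]; push_cast; linarith) (by simpa using hσ1) one_pos
  have hJ := integrable_hyperIntegrand le_rfl hσ0
    (memL1Weight_of_bounded hσ0 hcd.continuous hu1) hb hOb
  rw [← fracLapIntegrand_eq_hyperIntegrand] at hJ
  have hcore := hweak.integral_hyperIntegrand le_rfl hnm hcd.continuous.locallyIntegrable
    (fun _ => rfl) hI hJ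
  have hcoef : (-1 : ℝ) ^ n * powLapConst 1 n (-(((1 : ℕ) : ℝ) + 2 * σ)) ≠ 0 :=
    mul_ne_zero (pow_ne_zero _ (by norm_num)) (powLapConst_ne_zero 1 n hσ0)
  rw [hS, neg_zero, zero_mul, mul_eq_zero, or_iff_right hcoef] at hcore
  have hval (y : RN 1) : hyperIntegrand m (n + σ) u 0 y =
      (4 * Real.sin (y 0 / 2) ^ 2) ^ m / ‖y‖ ^ (((1 : ℕ) : ℝ) + 2 * (n + σ)) := by
    rw [hyperIntegrand, finDiff_eq_sum, ← sum_finDiffCoeff_mul_cos]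
    simp [u]
  have hnonneg : 0 ≤ hyperIntegrand m (n + σ) u 0 := fun y => by
    rw [hval]
    simp only [Pi.zero_apply]
    positivity
  rw [integral_eq_zero_iff_of_nonneg hnonneg hI] at hcore
  -- Between consecutive zeros of `sin(y/2)` the integrand is strictly positive, and this open set
  -- has positive measure.
  let O : Set (RN 1) := {y | 0 < y 0 ∧ y 0 < 2 * Real.pi}
  have hO : IsOpen O := by
    have hc : Continuous (fun y : RN 1 => y 0) := by fun_prop
    exact (isOpen_lt continuous_const hc).inter (isOpen_lt hc continuous_const)
  have hOne : O.Nonempty := ⟨EuclideanSpace.single 0 1, by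
    have := Real.pi_gt_three
    simp only [O, mem_ofPred_eq, PiLp.single_apply, if_true]
    constructor <;> linarith⟩
  refine (hO.measure_pos volume hOne).ne' ?_
  refine measure_mono_null (fun y hy => ?_) hcore
  have hy0 : y ≠ 0 := by
    rintro rfl
    simpa using hy.1
  have hsin : 0 < Real.sin (y 0 / 2) :=
    Real.sin_pos_of_pos_of_lt_pi (by linarith [hy.1]) (by linarith [hy.2])
  have hpos : 0 < ‖y‖ := norm_pos_iff.2 hy0
  simp only [mem_compl_iff, mem_ofPred_eq, Pi.zero_apply]
  rw [hval]
  positivity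

/-- Gamma recursion for the constants of the two operators. -/
theorem gamma_const_add (N n : ℕ) {σ : ℝ} (hσ0 : 0 < σ) :
    (4 : ℝ) ^ (n + σ) * Real.Gamma ((N : ℝ) / 2 + (n + σ)) /
        (Real.pi ^ ((N : ℝ) / 2) * Real.Gamma (-(n + σ))) =
      (-1) ^ n * powLapConst N n (-((N : ℝ) + 2 * σ)) *
        ((4 : ℝ) ^ σ * Real.Gamma ((N : ℝ) / 2 + σ) /
          (Real.pi ^ ((N : ℝ) / 2) * Real.Gamma (-σ))) := by
  induction n with
  | zero => simp [powLapConst]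
  | succ n ih =>
    have h1 : Real.Gamma ((N : ℝ) / 2 + (((n + 1 : ℕ) : ℝ) + σ)) =
        ((N : ℝ) / 2 + (n + σ)) * Real.Gamma ((N : ℝ) / 2 + (n + σ)) := by
      rw [← Real.Gamma_add_one (by positivity)]
      push_cast
      ring_nf
    have hne : -((n : ℝ) + 1 + σ) ≠ 0 := by
      have : 0 < (n : ℝ) + 1 + σ := by positivity
      linarith
    have h2 : Real.Gamma (-(((n + 1 : ℕ) : ℝ) + σ)) =
        Real.Gamma (-((n : ℝ) + σ)) * (-((n : ℝ) + 1 + σ))⁻¹ := by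
      have := Real.Gamma_add_one hne
      rw [show -((n : ℝ) + 1 + σ) + 1 = -((n : ℝ) + σ) by ring] at this
      rw [this]
      push_cast
      field_simp
    have h3 : (4 : ℝ) ^ (((n + 1 : ℕ) : ℝ) + σ) = 4 * (4 : ℝ) ^ ((n : ℝ) + σ) := by
      rw [show ((n + 1 : ℕ) : ℝ) + σ = 1 + (n + σ) by push_cast; ring,
        Real.rpow_add (by norm_num), Real.rpow_one]
    have h4 : powLapConst N (n + 1) (-((N : ℝ) + 2 * σ)) =
        powLapConst N n (-((N : ℝ) + 2 * σ)) *
          ((-((N : ℝ) + 2 * σ) - 2 * n) * (-((N : ℝ) + 2 * σ) - 2 * n - 2 + N)) :=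
      Finset.prod_range_succ _ _
    rw [h1, h2, h3, h4, pow_succ]
    -- The factor gained in one step is minus the new factor `(N + 2σ + 2n)(2σ + 2n + 2)` of
    -- `powLapConst`; the sign goes into `(-1)^(n+1)`.
    calc _ = (4 * ((N : ℝ) / 2 + (n + σ)) * (-((n : ℝ) + 1 + σ))) *
          ((4 : ℝ) ^ (n + σ) * Real.Gamma ((N : ℝ) / 2 + (n + σ)) /
            (Real.pi ^ ((N : ℝ) / 2) * Real.Gamma (-(n + σ)))) := by
          field_simp
      _ = _ := by
          rw [ih]
          ring

end NormalizingConstant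

/-! ### The pointwise identity and the theorem. -/

section MainResult

variable {N : ℕ}

/-- A common form for both halves of the theorem: regularity is needed only at `x`, and `v` may be
any representative that is classical near `x`, be it `negLapPow n u` or `classicalNegLapPow n u`. -/
theorem ContDiffPointwiseHolderAt.hyperL_eq_fracLap (hN : 1 ≤ N) {m n k : ℕ} (hnm : n < m) {σ : ℝ}
    (hσ0 : 0 < σ) (hσ1 : σ < 1) {u v : RN N → ℝ} {x : RN N} {α : unitInterval}
    (hreg : ContDiffPointwiseHolderAt k α u x) (hk : 2 * (n + σ) < k + α)
    (hus : MemL1Weight (n + σ) u) (hv : MemL1Weight σ v) (hweak : HasWeakNegLapPow n u v)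
    (hvx : v =ᶠ[𝓝 x] _root_.classicalNegLapPow n u) :
    Integrable (hyperIntegrand m (n + σ) u x) ∧ Integrable (fracLapIntegrand σ v x) ∧
      hyperL m (n + σ) u x = fracLap σ v x := by
  have hs : 0 < (n : ℝ) + σ := by positivity
  have hnm' : (n : ℝ) + 1 ≤ m := by exact_mod_cast hnm
  obtain ⟨a, ha, hOa⟩ := hreg.exists_finDiff_isBigO (m := m) hk (by linarith) (by omega)
  have hI := integrable_hyperIntegrand hN hs hus ha hOa
  -- From `2n < 2(n + σ) < k + α ≤ k + 1`; hence the Hölder exponent `α` survives `2n` derivatives.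
  have h2n : 2 * n ≤ k := by
    have h1 : 2 * (n : ℝ) < k + 1 := by linarith [α.2.2]
    have : 2 * n < k + 1 := by exact_mod_cast h1
    omega
  have hregv : ContDiffPointwiseHolderAt (k - 2 * n) α v x :=
    (hreg.classicalNegLapPow (by omega)).congr_of_eventuallyEq hvx.symm
  obtain ⟨b, hb, hOb⟩ := hregv.exists_finDiff_isBigO (m := 1) (s := σ)
    (by rw [Nat.cast_sub h2n]; push_cast; linarith) (by simpa using hσ1) one_pos
  have hJ := integrable_hyperIntegrand hN hσ0 hv hb hOb
  rw [← fracLapIntegrand_eq_hyperIntegrand] at hJ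
  refine ⟨hI, hJ, ?_⟩
  have hcore := hweak.integral_hyperIntegrand hN hnm hus.1 (x := x) (by
    rintro rfl
    rw [hvx.eq_of_nhds]
    simp [_root_.classicalNegLapPow]) hI hJ
  have hS := hyperSum_ne_zero hnm hσ0 hσ1
  have hconst : hyperConst N m (n + σ) = (-1) ^ n * powLapConst N n (-((N : ℝ) + 2 * σ)) *
        ((4 : ℝ) ^ σ * Real.Gamma ((N : ℝ) / 2 + σ) /
          (Real.pi ^ ((N : ℝ) / 2) * Real.Gamma (-σ))) * (hyperSum m (n + σ))⁻¹ := by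
    rw [← gamma_const_add N n hσ0]
    rfl
  have hhalf : (4 : ℝ) ^ σ * Real.Gamma ((N : ℝ) / 2 + σ) /
      (2 * Real.pi ^ ((N : ℝ) / 2) * Real.Gamma (-σ)) = (4 : ℝ) ^ σ * Real.Gamma ((N : ℝ) / 2 + σ) /
      (Real.pi ^ ((N : ℝ) / 2) * Real.Gamma (-σ)) / 2 := by
    rw [div_div]
    ring_nf
  rw [hyperL, fracLap, hconst, hhalf]
  generalize (4 : ℝ) ^ σ * Real.Gamma ((N : ℝ) / 2 + σ) /
      (Real.pi ^ ((N : ℝ) / 2) * Real.Gamma (-σ)) = G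
  calc _ = G / 2 * (hyperSum m (n + σ))⁻¹ * ((-1) ^ n * powLapConst N n (-((N : ℝ) + 2 * σ)) *
        ∫ y, hyperIntegrand m (n + σ) u x y) := by ring
    _ = _ := by
        rw [hcore]
        field_simp

theorem theorem1p2 (N m n : ℕ) (hN : 1 ≤ N) (hnm : n < m) (σ s : ℝ) (hσ0 : 0 < σ) (hσ1 : σ < 1)
    (hs : s = n + σ) :
    (∀ (β : ℝ) (U : Set (RN N)) (u : RN N → ℝ), 0 < β → IsOpen U →
      MemHolderLoc (2 * s + β) U u →
      MemW1Loc (2 * n) u →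
      MemL1Weight σ (negLapPow n u) →
      (∀ i < n, MemL1Weight (s - i - 1 / 2) (negLapPow i u)) →
      (∀ i < n, MemL1Weight (s - i - 1) (fun x => ‖weakGradient (negLapPow i u) x‖)) →
      ∀ x ∈ U,
        Integrable (hyperIntegrand m s u x) ∧
        Integrable (fracLapIntegrand σ (negLapPow n u) x) ∧
        hyperL m s u x = fracLap σ (negLapPow n u) x) ∧
    (∀ u : RN N → ℝ, ContDiff ℝ ∞ u → HasCompactSupport u →
      ∀ x : RN N,
        Integrable (hyperIntegrand m s u x) ∧
        Integrable (fracLapIntegrand σ (classicalNegLapPow n u) x) ∧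
        hyperL m s u x = fracLap σ (classicalNegLapPow n u) x) := by
  subst hs
  constructor
  · intro β U u hβ hU hH hW hLn hLi _ x hx
    obtain ⟨k, α, hkα, _, hreg⟩ := hH.contDiffPointwiseHolderAt hU hx
    have h2n : 2 * n ≤ k := by
      have h1 : 2 * (n : ℝ) < k + 1 := by linarith [α.2.2]
      have : 2 * n < k + 1 := by exact_mod_cast h1
      omega
    -- For `n = 0` this is the condition on `(-Δ)^n u`. For `n ≥ 1` it follows from the condition at
    -- `i = 0`, as the weighted spaces grow with their index and `s - 1/2 ≥ 0`.
    have hus : MemL1Weight (n + σ) u := by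
      rcases Nat.eq_zero_or_pos n with rfl | hn
      · simpa using hLn.congr_ae (negLapPow_zero_ae_eq hW.1)
      · have hn' : (1 : ℝ) ≤ n := by exact_mod_cast hn
        refine ((hLi 0 hn).congr_ae (negLapPow_zero_ae_eq hW.1)).mono ?_ ?_ <;>
        · push_cast
          linarith
    refine hreg.hyperL_eq_fracLap hN hnm hσ0 hσ1 (by linarith) hus hLn
      (hasWeakNegLapPow_negLapPow hW.exists_hasWeakNegLapPow) ?_
    filter_upwards [hreg.contDiffAt.eventually_nat] with y hy
    exact if_pos (hy.of_le (Nat.mono_cast h2n))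
  · intro u hu huc x
    have hut : IsTestFun u := ⟨hu, huc⟩
    -- Any order above `2s` would do; `2m + 1` is enough since `s < m`.
    have hreg : ContDiffPointwiseHolderAt (2 * m) 1 u x :=
      hu.contDiffAt.contDiffPointwiseHolderAt
        (lt_of_lt_of_le (by exact_mod_cast Nat.lt_succ_self _) (natCast_le_infty (2 * m + 1))) 1
    refine hreg.hyperL_eq_fracLap hN hnm hσ0 hσ1 ?_ (memL1Weight_of_isTestFun _ hut)
      (memL1Weight_of_isTestFun _ (hut.classicalNegLapPow n))
      (hasWeakNegLapPow_classicalNegLapPow hu) (Filter.EventuallyEq.refl _ _)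
    have hnm' : (n : ℝ) + 1 ≤ m := by exact_mod_cast hnm
    have hone : ((1 : unitInterval) : ℝ) = 1 := rfl
    rw [hone]
    push_cast
    linarith

end MainResult
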